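/- Let $\mathcal D$ be the space dimension and fix $c>0$, $w:=\omega_p^2/\epsilon_r\ge 0$, $\gamma\ge 0$. For a time step $\Delta t>0$ and grid spacings $h_d>0$ consider, for grid functions $E^n_j,\psi^n_j\in\mathbb R^3$ ($j\in\mathbb Z^{\mathcal D}$, $n\ge 0$), the second-order recursive convolution scheme $$E^{n+2}_j=2E^{n+1}_j-E^{n}_j+\Delta t^2\big(c^2\Delta_{2h}E^{n+1}_j-wE^{n+1}_j+w\gamma\psi^{n+1}_j\big),\qquad \psi^{n+1}_j=\tfrac{\Delta t}{2}E^{n+1}_j+\tfrac{\Delta t}{2}e^{-\gamma\Delta t}E^n_j+e^{-\gamma\Delta t}\psi^n_j,$$ where $\Delta_{2h}=\sum_d D_{+,d}D_{-,d}$ is the standard second-order discrete Laplacian ($D_{\pm,d}$ the forward/backward divided differences), with square-summable starting data $E^0,E^1,\psi^0$. Put $v^n=(E^{n+1}-E^n)/\Delta t$, $\|u\|_h^2=h_1\cdots h_{\mathcal D}\sum_j|u_j|^2$, and $$\Lambda=c\Delta t\sqrt{\textstyle\sum_d h_d^{-2}},\qquad \Omega=\sqrt{w\,\Delta t^2},\qquad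 \Gamma=\gamma\Delta t .$$ **(1) Finite-time stability.** For every $q<1$ the scheme is stable under the condition $\Lambda+\Omega^2/4\le q$: for every $T>0$ there are $\kappa,\beta,\delta>0$ (depending only on $\mathcal D,c,w,\gamma,q,T$) such that whenever $0<\Delta t<\delta$, $0<h_d<\delta$ and $\Lambda+\Omega^2/4\le q$, for all $n$ with $t=n\Delta t\le T$ the functions $E^n,\psi^n$ are square summable and $$\|(E^n,v^n,\psi^n)\|_{\rm en}\le\kappa e^{\beta t}\,\|(E^0,v^0,\psi^0)\|_{\rm en},\qquad \|(E,v,\psi)\|_{\rm en}^2=\|E\|_h^2+\|v\|_h^2+\sum_d\|D_{+,d}E\|_h^2+\|\psi\|_h^2 .$$ Likewise (for every $q<1$ and $T>0$, with some such constants) $$\big(\|E^n\|_h^2+\|\psi^n\|_h^2\big)^{1/2}\le\kappa e^{\beta t}\big(\|E^0\|_h^2+\|v^0\|_h^2+\|\psi^0\|_h^2\big)^{1/2}.$$ **(2) Amplification factors.** Inserting $E^n_j=C_EA^ne^{i\xi\cdot j}$, $\gamma\psi^n_j=C_\Psi A^ne^{i\xi\cdot j}$ gives a $2\times2$ linear system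 for $(C_E,C_\Psi)$ with matrix $$\begin{pmatrix}-A^2+2A-1-SA-\Omega^2A&\Omega^2A\\ \tfrac{\Gamma}{2}(A+e^{-\Gamma})&-A+e^{-\Gamma}\end{pmatrix},\qquad S=\sum_d 4\Big(\frac{c\Delta t}{h_d}\Big)^2\sin^2\frac{\xi_d}{2},$$ whose determinant is a monic cubic $A^3+c_2A^2+c_1A+c_0$. For the constant mode ($S=0$), $\Gamma>0$ and $0<\Omega<2$, denote by $A_0(\Omega,\Gamma)=\zeta_--\tfrac{c_2}{3}$ and $A_\pm(\Omega,\Gamma)=-\tfrac{\zeta_-}{2}-\tfrac{c_2}{3}\pm\tfrac{i\sqrt3}{2}\zeta_+$ the numbers given by the cubic formula, where $\zeta_\pm=\tfrac{\eta}{6}\pm 6\,\tfrac{3c_1-c_2^2}{9\eta}$, $\eta=\big(36c_1c_2-108c_0-8c_2^3+12\sqrt{12c_0c_2^3-3c_1^2c_2^2-54c_2c_1c_0+12c_1^3+81c_0^2}\big)^{1/3}$, with principal square and cube roots. Then: * for the constant mode, $\Gamma>0$, $0<\Omega<2$, the three roots of the cubic (with multiplicity) are $A_0,A_+,A_-$;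 moreover $A_0$ is real, $A_0>1$, and $|A_\pm|<1$; * if $w,\gamma>0$, then for all $\Delta t,h_d>0$ with $\Lambda+\Omega^2/4<1$ and every $\xi\in\mathbb R^{\mathcal D}$ the three roots of the cubic (with multiplicity) can be labelled $A_0^\xi,A_+^\xi,A_-^\xi$ with $|A_\pm^\xi|<1$, $A_0^\xi$ real and $0<A_0^\xi\le A_0(\Omega,\Gamma)$. **(3) The spurious root.** For every fixed $0<\Omega<2$, $A_0(\Omega,\Gamma)=1+\Gamma^3/12+O(\Gamma^4)$ as $\Gamma\to0^+$. If $w,\gamma>0$, then also, as $\Delta t\to0^+$ with $\Omega=\sqrt{w\Delta t^2}$ and $\Gamma=\gamma\Delta t$, $A_0=1+\Gamma^3/12+O(\Delta t^4)$; its growth rate in physical time satisfies $\Delta t^{-1}\log|A_0|=O(\Delta t^2)$ and so tends to $0$. -/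

import Mathlib

open Filter Topology Asymptotics

noncomputable section

namespace RC2

/-- Vector-valued (three-component) grid functions on the infinite grid `ℤ^D`. -/
abbrev GridField (D : ℕ) : Type := (Fin D → ℤ) → EuclideanSpace ℝ (Fin 3)

/-- Forward divided difference in direction `d`. -/
def dPlus {D : ℕ} (h : Fin D → ℝ) (d : Fin D) (u : GridField D) : GridField D :=
  fun j => (h d)⁻¹ • (u (j + Pi.single d 1) - u j)

/-- Backward divided difference in direction `d`. -/
def dMinus {D : ℕ} (h : Fin D → ℝ) (d : Fin D) (u : GridField D) : GridField D :=
  fun j => (h d)⁻¹ • (u j - u (j - Pi.single d 1))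

/-- The standard second-order discrete Laplacian. -/
def lap {D : ℕ} (h : Fin D → ℝ) (u : GridField D) : GridField D :=
  fun j => ∑ d, dPlus h d (dMinus h d u) j

/-- `E n`, `ψ n` (time levels `n = 0, 1, 2, …`) solve the second-order recursive convolution
scheme on the whole grid; `w2` stands for `ω_p² / ε_r`. The starting data are `E 0`, `E 1`
and `ψ 0`; everything else is determined by the two recursions. -/
def IsSolution {D : ℕ} (c w2 γ dt : ℝ) (h : Fin D → ℝ) (E ψ : ℕ → GridField D) : Prop :=
  (∀ n j, E (n + 2) j = (2 : ℝ) • E (n + 1) j - E n j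
      + dt ^ 2 • (c ^ 2 • lap h (E (n + 1)) j - w2 • E (n + 1) j + (w2 * γ) • ψ (n + 1) j)) ∧
  (∀ n j, ψ (n + 1) j = (dt / 2) • E (n + 1) j
      + (dt / 2 * Real.exp (-(γ * dt))) • E n j + Real.exp (-(γ * dt)) • ψ n j)

/-- Square-summable grid functions. -/
def SqSummable {D : ℕ} (u : GridField D) : Prop := Summable fun j => ‖u j‖ ^ 2

/-- The discrete `L²` norm `(h_1 ⋯ h_D ∑_j |u_j|²)^{1/2}`. -/
def l2Norm {D : ℕ} (h : Fin D → ℝ) (u : GridField D) : ℝ :=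
  Real.sqrt ((∏ d, h d) * ∑' j, ‖u j‖ ^ 2)

/-- The state of the three-level scheme at a time level: the field, its divided time difference
and the convolution variable. -/
structure GridState (D : ℕ) where
  E : GridField D
  v : GridField D
  ψ : GridField D

/-- The state `(E^n, (E^{n+1} - E^n) / Δt, ψ^n)` of a grid solution at time level `n`. -/
def stateAt {D : ℕ} (dt : ℝ) (E ψ : ℕ → GridField D) (n : ℕ) : GridState D where
  E := E n
  v := fun j => dt⁻¹ • (E (n + 1) j - E n j)
  ψ := ψ n

/-- Discrete energy norm of a state. -/
def energyNorm {D : ℕ} (h : Fin D → ℝ) (u : GridState D) : ℝ :=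
  Real.sqrt (l2Norm h u.E ^ 2 + l2Norm h u.v ^ 2 + ∑ d, l2Norm h (dPlus h d u.E) ^ 2
    + l2Norm h u.ψ ^ 2)

/-- Discrete `L²` norm of the pair `(E, ψ)`. -/
def fieldNorm {D : ℕ} (h : Fin D → ℝ) (u : GridState D) : ℝ :=
  Real.sqrt (l2Norm h u.E ^ 2 + l2Norm h u.ψ ^ 2)

/-- Discrete `L²` norm of the triple `(E, v, ψ)`. -/
def dataNorm {D : ℕ} (h : Fin D → ℝ) (u : GridState D) : ℝ :=
  Real.sqrt (l2Norm h u.E ^ 2 + l2Norm h u.v ^ 2 + l2Norm h u.ψ ^ 2)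

/-- Finite-time stability of the scheme, over all time steps and grid spacings satisfying `adm`,
when the solution is measured in `N` and its initial data in `N₀`: for every final time `T`
there are `κ, β > 0`, independent of `Δt` and `h`, such that for all sufficiently small `Δt`
and `h` the solution at time `t = n Δt ≤ T` is bounded by `κ e^{β t}` times the data. -/
def FiniteTimeStable {D : ℕ} (c w2 γ : ℝ) (adm : ℝ → (Fin D → ℝ) → Prop)
    (N N₀ : (Fin D → ℝ) → GridState D → ℝ) : Prop :=
  ∀ T : ℝ, 0 < T → ∃ κ β δ : ℝ, 0 < κ ∧ 0 < β ∧ 0 < δ ∧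
    ∀ (dt : ℝ) (h : Fin D → ℝ), 0 < dt → dt < δ → (∀ d, 0 < h d) → (∀ d, h d < δ) →
      adm dt h →
      ∀ E ψ : ℕ → GridField D, IsSolution c w2 γ dt h E ψ →
        SqSummable (E 0) → SqSummable (E 1) → SqSummable (ψ 0) →
        ∀ n : ℕ, (n : ℝ) * dt ≤ T →
          SqSummable (E n) ∧ SqSummable (ψ n) ∧
          N h (stateAt dt E ψ n) ≤ κ * Real.exp (β * (n * dt)) * N₀ h (stateAt dt E ψ 0)

/-- `Λ = c Δt √(∑ 1 / h_d²)`. -/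
def cflNumber {D : ℕ} (c dt : ℝ) (h : Fin D → ℝ) : ℝ :=
  c * dt * Real.sqrt (∑ d, 1 / h d ^ 2)

/-- `Ω = √(Δt² ω_p² / ε_r)`. -/
def plasmaNumber (w2 dt : ℝ) : ℝ := Real.sqrt (dt ^ 2 * w2)

/-- `∑_d 4 λ_d² sin²(ξ_d / 2)` with `λ_d = c Δt / h_d`. -/
def lapSymbol {D : ℕ} (c dt : ℝ) (h ξ : Fin D → ℝ) : ℝ :=
  ∑ d, 4 * (c * dt / h d) ^ 2 * Real.sin (ξ d / 2) ^ 2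

/-- The matrix of the linear system for `(C_E, C_Ψ)` obtained by inserting
`E = C_E A^n e^{i k·x}`, `γ ψ = C_Ψ A^n e^{i k·x}` into the scheme; `S` is the value of
`lapSymbol`, `Ω` of `plasmaNumber`, and `Γ = γ Δt`. -/
def ampMatrix (S Ω Γ : ℝ) (A : ℂ) : Matrix (Fin 2) (Fin 2) ℂ :=
  !![-A ^ 2 + 2 * A - 1 - (S : ℂ) * A - (Ω : ℂ) ^ 2 * A, (Ω : ℂ) ^ 2 * A;
     (Γ : ℂ) / 2 * (A + (Real.exp (-Γ) : ℂ)), -A + (Real.exp (-Γ) : ℂ)]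

/-- Coefficients of `det (ampMatrix S Ω Γ A) = A³ + c₂ A² + c₁ A + c₀`. -/
def coeff2 (S Ω Γ : ℝ) : ℝ := S + Ω ^ 2 - Real.exp (-Γ) - 2 - Ω ^ 2 * Γ / 2

/-- See `coeff2`. -/
def coeff1 (S Ω Γ : ℝ) : ℝ :=
  -S * Real.exp (-Γ) - Ω ^ 2 * Real.exp (-Γ) + 2 * Real.exp (-Γ) + 1
    - Ω ^ 2 * Γ * Real.exp (-Γ) / 2

/-- See `coeff2`. -/
def coeff0 (Γ : ℝ) : ℝ := -Real.exp (-Γ)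

theorem det_ampMatrix (S Ω Γ : ℝ) (A : ℂ) :
    (ampMatrix S Ω Γ A).det
      = A ^ 3 + (coeff2 S Ω Γ : ℂ) * A ^ 2 + (coeff1 S Ω Γ : ℂ) * A + (coeff0 Γ : ℂ) := by
  rw [ampMatrix, Matrix.det_fin_two_of, coeff2, coeff1, coeff0]
  push_cast
  ring

/-- Cubic formula for `A³ + c₂ A² + c₁ A + c₀`, with principal square and cube roots. -/
def eta (c2 c1 c0 : ℂ) : ℂ :=
  (36 * c1 * c2 - 108 * c0 - 8 * c2 ^ 3
    + 12 * (12 * c0 * c2 ^ 3 - 3 * c1 ^ 2 * c2 ^ 2 - 54 * c2 * c1 * c0 + 12 * c1 ^ 3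
      + 81 * c0 ^ 2) ^ (1 / 2 : ℂ)) ^ (1 / 3 : ℂ)

def zetaPlus (c2 c1 c0 : ℂ) : ℂ :=
  eta c2 c1 c0 / 6 + 6 * ((3 * c1 - c2 ^ 2) / (9 * eta c2 c1 c0))

def zetaMinus (c2 c1 c0 : ℂ) : ℂ :=
  eta c2 c1 c0 / 6 - 6 * ((3 * c1 - c2 ^ 2) / (9 * eta c2 c1 c0))

/-- The spurious root `A₀` of the constant mode (`ξ = 0`, so `S = 0`). -/
def spuriousRoot (Ω Γ : ℝ) : ℂ :=
  zetaMinus (coeff2 0 Ω Γ) (coeff1 0 Ω Γ) (coeff0 Γ) - (coeff2 0 Ω Γ : ℂ) / 3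

/-- The roots `A_±` of the constant mode, with `σ = ±1`. -/
def pairRoot (σ : ℂ) (Ω Γ : ℝ) : ℂ :=
  -zetaMinus (coeff2 0 Ω Γ) (coeff1 0 Ω Γ) (coeff0 Γ) / 2 - (coeff2 0 Ω Γ : ℂ) / 3
    + σ * (Complex.I * zetaPlus (coeff2 0 Ω Γ) (coeff1 0 Ω Γ) (coeff0 Γ) / 2
      * (Real.sqrt 3 : ℂ))

end RC2

end

/-! Stability is an energy argument. On square-summable grid fields the scheme is leapfrog for a
symmetric nonnegative operator `L = w - c²Δ_h`, forced by the bounded term `wγψ`. Unforced leapfrog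
conserves `‖v‖² + ⟪L Eⁿ, Eⁿ⁺¹⟫`. Written at the midpoint `Eⁿ + (Δt/2)v`, its only negative part is
`-(Δt²/4)⟪Lv, v⟫`, so `Δt²L ≤ 4q` with `q < 1` makes it control `(1 - q)‖v‖²`; `Λ + Ω²/4 ≤ q`
implies this operator bound (`spatialOp_cfl`). The forcing and the growth of `E` and `ψ` cost a
factor `1 + O(Δt)` per step, which Gronwall absorbs (`coupled_growth`). For the estimate without
gradients of the data, the scheme is summed once in time: the running sum of `E` solves leapfrog
again, starts from zero, and has `E` itself as velocity (`integrated_growth`).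

The roots are located through signs of the real cubic. It is negative at `e^{-Γ}`, and at `-1` when
`S + Ω² < 4`; hence it has a real root `r > e^{-Γ}`, and since the three roots multiply to `e^{-Γ}`,
Jury's conditions put the other two in the open unit disc. For `S = 0` the value at `1` is `Ω²`
times the negative of a trapezoidal quadrature error for `∫₀^Γ e^{-s} ds`; the integrand is convex,
so this value is negative and `r > 1`. Increasing `S` raises the cubic to the right of `e^{-Γ}`, so
the constant mode has the largest `r`. The radicals in the cubic formula are the Lagrange resolvents
of `r` and the pair `a ± iβ`, and the ordering of the roots shows that the principal branches are
the right ones (`eta_eq`). Finally, the cubic at `1 + x` is a perturbation of `x = Γ³/12`, the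
leading quadrature error. -/

noncomputable section

namespace RC2

/-! ### Signs of the characteristic cubic -/

/-- The characteristic polynomial `det (ampMatrix S Ω Γ x)` at a real argument. -/
def charCubic (S Ω Γ x : ℝ) : ℝ :=
  x ^ 3 + coeff2 S Ω Γ * x ^ 2 + coeff1 S Ω Γ * x + coeff0 Γ

/-- The leapfrog quadratic times the decay factor of the convolution, minus their coupling: in this
form the signs at `e^{-Γ}` and `±1` can be read off. -/
theorem charCubic_eq (S Ω Γ x : ℝ) :
    charCubic S Ω Γ x = (x ^ 2 - (2 - S - Ω ^ 2) * x + 1) * (x - Real.exp (-Γ))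
      - Ω ^ 2 * Γ / 2 * x * (x + Real.exp (-Γ)) := by
  rw [charCubic, coeff2, coeff1, coeff0]
  ring

theorem continuous_charCubic (S Ω Γ : ℝ) : Continuous (charCubic S Ω Γ) := by
  unfold charCubic
  fun_prop

theorem charCubic_exp_neg {Ω Γ : ℝ} (S : ℝ) (hΩ : 0 < Ω) (hΓ : 0 < Γ) :
    charCubic S Ω Γ (Real.exp (-Γ)) < 0 := by
  have he := Real.exp_pos (-Γ)
  rw [charCubic_eq]
  have : 0 < Ω ^ 2 * Γ * Real.exp (-Γ) ^ 2 := by positivity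
  nlinarith

theorem charCubic_neg_one {S Ω Γ : ℝ} (hΓ : 0 < Γ) (hS : S + Ω ^ 2 < 4) :
    charCubic S Ω Γ (-1) < 0 := by
  have he := Real.exp_pos (-Γ)
  have he1 : Real.exp (-Γ) < 1 := Real.exp_lt_one_iff.2 (by linarith)
  rw [charCubic_eq]
  have h1 : 0 < (4 - S - Ω ^ 2) * (1 + Real.exp (-Γ)) := mul_pos (by linarith) (by linarith)
  have h2 : 0 ≤ Ω ^ 2 * Γ / 2 * (1 - Real.exp (-Γ)) :=
    mul_nonneg (by positivity) (by linarith)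
  nlinarith

/-- `tanh (Γ/2) < Γ/2`, written with exponentials. -/
theorem one_sub_exp_neg_lt {Γ : ℝ} (hΓ : 0 < Γ) :
    1 - Real.exp (-Γ) < Γ / 2 * (1 + Real.exp (-Γ)) := by
  have hanti : StrictAntiOn
      (fun x : ℝ => 1 - Real.exp (-x) - x / 2 * (1 + Real.exp (-x))) (Set.Ici 0) := by
    apply strictAntiOn_of_deriv_neg (convex_Ici 0)
    · fun_prop
    · intro x hx
      rw [interior_Ici] at hx
      have hx : 0 < x := hx
      have hd : HasDerivAt (fun x : ℝ => 1 - Real.exp (-x) - x / 2 * (1 + Real.exp (-x)))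
          (-(Real.exp (-x) * -1) - (1 / 2 * (1 + Real.exp (-x))
            + x / 2 * (Real.exp (-x) * -1))) x := by
        have h1 : HasDerivAt (fun x : ℝ => Real.exp (-x)) (Real.exp (-x) * -1) x :=
          (hasDerivAt_neg x).exp
        have h2 : HasDerivAt (fun x : ℝ => x / 2) (1 / 2) x := (hasDerivAt_id x).div_const 2
        exact (h1.const_sub 1).sub (h2.mul (h1.const_add 1))
      rw [hd.deriv]
      -- The derivative equals `((1 + x)e^{-x} - 1)/2`.
      have h3 : x + 1 < Real.exp x := Real.add_one_lt_exp hx.ne'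
      have h4 : Real.exp x * Real.exp (-x) = 1 := by rw [← Real.exp_add]; simp
      nlinarith [Real.exp_pos (-x)]
  have := hanti (Set.mem_Ici.2 le_rfl) (Set.mem_Ici.2 hΓ.le) hΓ
  simp at this
  linarith

/-- At `1` the quadratic factor reduces to `Ω²`, leaving `Ω²` times the exact integral of `e^{-s}`
over `[0, Γ]` minus its trapezoidal value. This quadrature error is what pushes the real root beyond
`1`. -/
theorem charCubic_zero_one {Ω Γ : ℝ} (hΩ : 0 < Ω) (hΓ : 0 < Γ) : charCubic 0 Ω Γ 1 < 0 := by
  have h := mul_pos (pow_pos hΩ 2) (sub_pos.2 (one_sub_exp_neg_lt hΓ))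
  rw [charCubic_eq]
  nlinarith

theorem exists_gt_charCubic_pos (S Ω Γ x₀ : ℝ) : ∃ x, x₀ < x ∧ 0 < charCubic S Ω Γ x := by
  set K := |x₀| + 1 + |coeff2 S Ω Γ| + |coeff1 S Ω Γ| + |coeff0 Γ| with hK
  have h0 := abs_nonneg x₀
  have h2 := abs_nonneg (coeff2 S Ω Γ)
  have h1 := abs_nonneg (coeff1 S Ω Γ)
  have h3 := abs_nonneg (coeff0 Γ)
  have hK1 : 1 ≤ K := by linarith
  refine ⟨K, by linarith [le_abs_self x₀], ?_⟩
  have e2 := neg_abs_le (coeff2 S Ω Γ)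
  have e1 := neg_abs_le (coeff1 S Ω Γ)
  have e0 := neg_abs_le (coeff0 Γ)
  have hKK : K ≤ K ^ 2 := by nlinarith
  have hb2 : -|coeff2 S Ω Γ| * K ^ 2 ≤ coeff2 S Ω Γ * K ^ 2 :=
    mul_le_mul_of_nonneg_right e2 (by positivity)
  have hb1 : -|coeff1 S Ω Γ| * K ^ 2 ≤ coeff1 S Ω Γ * K := by nlinarith
  have hb0 : -|coeff0 Γ| * K ^ 2 ≤ coeff0 Γ := by nlinarith
  have : K ^ 3 = (|x₀| + 1 + |coeff2 S Ω Γ| + |coeff1 S Ω Γ| + |coeff0 Γ|) * K ^ 2 := by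
    rw [← hK]; ring
  have hpos : 0 < (|x₀| + 1) * K ^ 2 := by positivity
  rw [charCubic]
  nlinarith

/-- A real root beyond `e^{-Γ}`, on the side of `1` prescribed by the sign at `1`. -/
theorem exists_root_charCubic {S Ω Γ : ℝ} (hΩ : 0 < Ω) (hΓ : 0 < Γ) :
    ∃ r, Real.exp (-Γ) < r ∧ charCubic S Ω Γ r = 0 ∧
      (charCubic S Ω Γ 1 < 0 → 1 < r) ∧ (charCubic S Ω Γ 1 = 0 → r = 1) ∧
      (0 < charCubic S Ω Γ 1 → r < 1) := by
  have he1 : Real.exp (-Γ) < 1 := Real.exp_lt_one_iff.2 (by linarith)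
  rcases lt_trichotomy (charCubic S Ω Γ 1) 0 with h | h | h
  · obtain ⟨x, hx, hpx⟩ := exists_gt_charCubic_pos S Ω Γ 1
    obtain ⟨r, hr, hr0⟩ := intermediate_value_Ioo hx.le
      (continuous_charCubic S Ω Γ).continuousOn (Set.mem_Ioo.2 ⟨h, hpx⟩)
    exact ⟨r, he1.trans hr.1, hr0, fun _ => hr.1, fun h' => absurd h' h.ne,
      fun h' => absurd h' h.not_gt⟩
  · exact ⟨1, he1, h, fun h' => absurd h h'.ne, fun _ => rfl, fun h' => absurd h h'.ne'⟩
  · obtain ⟨r, hr, hr0⟩ := intermediate_value_Ioo he1.le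
      (continuous_charCubic S Ω Γ).continuousOn
      (Set.mem_Ioo.2 ⟨charCubic_exp_neg S hΩ hΓ, h⟩)
    exact ⟨r, hr.1, hr0, fun h' => absurd h h'.not_gt, fun h' => absurd h' h.ne', fun _ => hr.2⟩

/-! ### Location of the three roots -/

/-- Jury's criterion for a real quadratic, together with a normal form of its roots. -/
theorem exists_roots_of_jury {b d : ℝ} (hd : d < 1) (h1 : 0 < 1 + b + d)
    (h2 : 0 < 1 - b + d) :
    ∃ (a s : ℝ) (β : ℂ), 0 ≤ s ∧ (β = (s : ℂ) ∨ β = Complex.I * (s : ℂ) ∧ a + s < 1) ∧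
      a < 1 ∧ b = -2 * a ∧ (d : ℂ) = (a : ℂ) ^ 2 + β ^ 2 ∧
      ‖(a : ℂ) + Complex.I * β‖ < 1 ∧ ‖(a : ℂ) - Complex.I * β‖ < 1 := by
  set a := -b / 2 with ha
  have hb : b = -2 * a := by rw [ha]; ring
  rcases le_or_gt (a ^ 2) d with h | h
  · have hs := Real.sq_sqrt (sub_nonneg.2 h)
    set s := Real.sqrt (d - a ^ 2) with hsdef
    refine ⟨a, s, s, Real.sqrt_nonneg _, Or.inl rfl, by nlinarith, hb, ?_, ?_, ?_⟩
    · exact_mod_cast (by linarith : d = a ^ 2 + s ^ 2)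
    · rw [← sq_lt_one_iff₀ (norm_nonneg _), Complex.sq_norm, Complex.normSq_apply]
      simp
      nlinarith
    · rw [← sq_lt_one_iff₀ (norm_nonneg _), Complex.sq_norm, Complex.normSq_apply]
      simp
      nlinarith
  · have hs := Real.sq_sqrt (sub_nonneg.2 h.le)
    have hs0 := Real.sqrt_nonneg (a ^ 2 - d)
    set s := Real.sqrt (a ^ 2 - d) with hsdef
    have hq1 : s ^ 2 < (1 - a) ^ 2 := by nlinarith
    have hq2 : s ^ 2 < (1 + a) ^ 2 := by nlinarith
    have k1 := sq_lt_sq.1 hq1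
    have k2 := sq_lt_sq.1 hq2
    rw [abs_of_nonneg hs0] at k1 k2
    -- If `a ≥ 1`, then `s < a - 1` gives `d = a² - s² > 2a - 1 ≥ 1`. The bound `-1 < a` is
    -- symmetric.
    have ha1 : a < 1 := by
      by_contra hcon
      rw [abs_of_nonpos (by linarith)] at k1
      nlinarith
    have ha2 : -1 < a := by
      by_contra hcon
      rw [abs_of_nonpos (by linarith)] at k2
      nlinarith
    rw [abs_of_pos (by linarith)] at k1 k2
    have e1 : (a : ℂ) + Complex.I * (Complex.I * (s : ℂ)) = ((a - s : ℝ) : ℂ) := by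
      rw [← mul_assoc, Complex.I_mul_I]; push_cast; ring
    have e2 : (a : ℂ) - Complex.I * (Complex.I * (s : ℂ)) = ((a + s : ℝ) : ℂ) := by
      rw [← mul_assoc, Complex.I_mul_I]; push_cast; ring
    refine ⟨a, s, Complex.I * s, hs0, Or.inr ⟨rfl, by linarith⟩, ha1, hb, ?_, ?_, ?_⟩
    · rw [mul_pow, Complex.I_sq]
      exact_mod_cast (by linarith : d = a ^ 2 + -1 * s ^ 2)
    · rw [e1, Complex.norm_real, Real.norm_eq_abs, abs_lt]
      constructor <;> linarith
    · rw [e2, Complex.norm_real, Real.norm_eq_abs, abs_lt]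
      constructor <;> linarith

/-- The roots of the characteristic polynomial: a real one, `r`, and the pair `a ± iβ` in the
open unit disc, with `β` real or imaginary. -/
theorem exists_factorization {S Ω Γ : ℝ} (hΩ : 0 < Ω) (hΓ : 0 < Γ) (hS : S + Ω ^ 2 < 4) :
    ∃ (r a s : ℝ) (β : ℂ), 0 ≤ s ∧ (β = (s : ℂ) ∨ β = Complex.I * (s : ℂ) ∧ a + s < 1) ∧
      a < 1 ∧ (coeff2 S Ω Γ : ℂ) = -(r + 2 * a) ∧
      (coeff1 S Ω Γ : ℂ) = 2 * r * a + (a ^ 2 + β ^ 2) ∧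
      (coeff0 Γ : ℂ) = -r * (a ^ 2 + β ^ 2) ∧
      ‖(a : ℂ) + Complex.I * β‖ < 1 ∧ ‖(a : ℂ) - Complex.I * β‖ < 1 ∧ Real.exp (-Γ) < r ∧
      (charCubic S Ω Γ 1 < 0 → 1 < r) := by
  have he := Real.exp_pos (-Γ)
  have he1 : Real.exp (-Γ) < 1 := Real.exp_lt_one_iff.2 (by linarith)
  obtain ⟨r, hr, hr0, hlt, heq, hgt⟩ := exists_root_charCubic (S := S) hΩ hΓ
  set b := coeff2 S Ω Γ + r with hb
  set d := coeff1 S Ω Γ + r * b with hd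
  have hrd : coeff0 Γ = -r * d := by rw [charCubic] at hr0; rw [hd, hb]; linarith
  have hfac : ∀ x, charCubic S Ω Γ x = (x - r) * (x ^ 2 + b * x + d) := by
    intro x; rw [charCubic, hrd]; rw [hd, hb]; ring
  have hrpos : 0 < r := he.trans hr
  have hre : r * d = Real.exp (-Γ) := by rw [coeff0] at hrd; linarith
  -- `d = e^{-Γ}/r` and `r > e^{-Γ}`.
  have hd1 : d < 1 := by
    by_contra hcon
    nlinarith
  have hneg : 0 < 1 - b + d := by
    have h := charCubic_neg_one hΓ hS
    rw [hfac] at h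
    by_contra hcon
    nlinarith
  -- The cubic at `1` is `(1 - r)(1 + b + d)`, and `r` was chosen on the side of `1` that makes the
  -- second factor positive. If `r = 1` this says nothing; then `d = e^{-Γ}`, and negativity of the
  -- cubic at `e^{-Γ}` gives `d(1 + b + d) > 0`.
  have hpos : 0 < 1 + b + d := by
    rcases lt_trichotomy (charCubic S Ω Γ 1) 0 with h | h | h
    · have h' := hlt h
      rw [hfac] at h
      by_contra hcon
      nlinarith
    · have h' := heq h
      have h3 := charCubic_exp_neg S hΩ hΓ
      rw [hfac, h'] at h3
      rw [h', one_mul] at hre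
      rw [← hre] at h3 he he1
      by_contra hcon
      have h4 : 0 < d ^ 2 + b * d + d := by
        by_contra hcon'
        nlinarith
      nlinarith
    · have h' := hgt h
      rw [hfac] at h
      by_contra hcon
      nlinarith
  obtain ⟨a, s, β, hs, hβ, ha, hba, hdβ, hn1, hn2⟩ := exists_roots_of_jury hd1 hpos hneg
  refine ⟨r, a, s, β, hs, hβ, ha, ?_, ?_, ?_, hn1, hn2, hr, hlt⟩
  · have : coeff2 S Ω Γ = -(r + 2 * a) := by linarith
    exact_mod_cast this
  · rw [← hdβ]
    have : coeff1 S Ω Γ = 2 * r * a + d := by rw [hd, hba]; ring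
    exact_mod_cast this
  · rw [← hdβ]
    exact_mod_cast hrd

/-! ### Branches of the cubic formula -/

/-- The principal branches in `eta` pick the Lagrange resolvent of the largest root. -/
theorem eta_eq {r a s : ℝ} {β c2 c1 c0 : ℂ} (hs : 0 ≤ s)
    (hβ : β = (s : ℂ) ∨ β = Complex.I * (s : ℂ) ∧ a + s < 1) (ha : a < 1) (hr : 1 < r)
    (h2 : c2 = -(r + 2 * a)) (h1 : c1 = 2 * r * a + (a ^ 2 + β ^ 2))
    (h0 : c0 = -r * (a ^ 2 + β ^ 2)) :
    eta c2 c1 c0 = 2 * (r - a + (Real.sqrt 3 : ℝ) * β) ∧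
      (r - a + (Real.sqrt 3 : ℝ) * β : ℂ) ≠ 0 := by
  have h3 : ((Real.sqrt 3 : ℝ) : ℂ) ^ 2 = 3 := by
    exact_mod_cast Real.sq_sqrt (by norm_num : (0 : ℝ) ≤ 3)
  have h3pos : 0 < Real.sqrt 3 := by positivity
  set t : ℝ := Real.sqrt 3 with ht
  have hpi := Real.pi_pos
  have hsq : (12 * c0 * c2 ^ 3 - 3 * c1 ^ 2 * c2 ^ 2 - 54 * c2 * c1 * c0 + 12 * c1 ^ 3
      + 81 * c0 ^ 2) ^ (1 / 2 : ℂ) = 2 * t * β * ((r - a) ^ 2 + β ^ 2) := by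
    -- The radicand is `-3` times the discriminant, hence a perfect square in the roots. The chosen
    -- square root lies on the positive real or positive imaginary axis (or is zero), so it is the
    -- principal one.
    have e : 12 * c0 * c2 ^ 3 - 3 * c1 ^ 2 * c2 ^ 2 - 54 * c2 * c1 * c0 + 12 * c1 ^ 3
      + 81 * c0 ^ 2 = (2 * t * β * ((r - a) ^ 2 + β ^ 2)) ^ 2 := by
      rw [h2, h1, h0]
      linear_combination (-(2 * β * ((r - a) ^ 2 + β ^ 2)) ^ 2) * h3
    have harg : -(Real.pi / (2 : ℕ)) < (2 * t * β * ((r - a) ^ 2 + β ^ 2)).arg ∧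
        (2 * t * β * ((r - a) ^ 2 + β ^ 2)).arg ≤ Real.pi / (2 : ℕ) := by
      rcases hβ with hβ | ⟨hβ, has⟩
      · have e : 2 * t * β * ((r - a) ^ 2 + β ^ 2)
            = ((2 * t * s * ((r - a) ^ 2 + s ^ 2) : ℝ) : ℂ) := by
          rw [hβ]; push_cast; ring
        rw [e, Complex.arg_ofReal_of_nonneg (by positivity)]
        constructor
        · have : 0 < Real.pi / (2 : ℕ) := by positivity
          linarith
        · positivity
      · have e : 2 * t * β * ((r - a) ^ 2 + β ^ 2)
            = ((2 * t * s * ((r - a) ^ 2 - s ^ 2) : ℝ) : ℂ) * Complex.I := by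
          rw [hβ, mul_pow, Complex.I_sq]; push_cast; ring
        have hk : 0 ≤ 2 * t * s * ((r - a) ^ 2 - s ^ 2) := by
          have : 0 ≤ (r - a) ^ 2 - s ^ 2 := by nlinarith
          positivity
        rw [e]
        rcases hk.eq_or_lt with hk | hk
        · rw [← hk]
          simp [hpi]
          positivity
        · rw [Complex.arg_real_mul _ hk, Complex.arg_I]
          constructor
          · push_cast; linarith
          · push_cast; exact le_rfl
    rw [e]
    have := Complex.pow_cpow_nat_inv (x := 2 * t * β * ((r - a) ^ 2 + β ^ 2)) (n := 2)
      (by norm_num) harg.1 harg.2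
    rw [one_div]
    exact_mod_cast this
  have hcube : 36 * c1 * c2 - 108 * c0 - 8 * c2 ^ 3
      + 12 * (2 * t * β * ((r - a) ^ 2 + β ^ 2)) = (2 * (r - a + t * β)) ^ 3 := by
    rw [h2, h1, h0]
    linear_combination (-(24 * (r - a) * β ^ 2 + 8 * t * β ^ 3)) * h3
  have hre : 0 < (2 * ((r : ℂ) - a + t * β)).re := by
    rcases hβ with hβ | ⟨hβ, has⟩
    · rw [hβ]
      simp
      have : 0 ≤ t * s := by positivity
      linarith
    · rw [hβ]
      simp
      linarith
  have harg : -(Real.pi / (3 : ℕ)) < (2 * ((r : ℂ) - a + t * β)).arg ∧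
      (2 * ((r : ℂ) - a + t * β)).arg ≤ Real.pi / (3 : ℕ) := by
    rcases hβ with hβ | ⟨hβ, has⟩
    · have e : 2 * ((r : ℂ) - a + t * β) = ((2 * (r - a + t * s) : ℝ) : ℂ) := by
        rw [hβ]; push_cast; ring
      have : 0 ≤ 2 * (r - a + t * s) := by
        have : 0 ≤ r - a := by linarith
        positivity
      rw [e, Complex.arg_ofReal_of_nonneg this]
      constructor
      · have : 0 < Real.pi / (3 : ℕ) := by positivity
        linarith
      · positivity
    · have him : (2 * ((r : ℂ) - a + t * β)).im = 2 * (t * s) := by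
        rw [hβ]; simp
      have hre' : (2 * ((r : ℂ) - a + t * β)).re = 2 * (r - a) := by
        rw [hβ]; simp
      have h0 : 0 ≤ (2 * ((r : ℂ) - a + t * β)).arg := by
        rw [Complex.arg_nonneg_iff, him]; positivity
      constructor
      · have : 0 < Real.pi / (3 : ℕ) := by positivity
        linarith
      -- For a real pair `a ± s`, the tangent of the argument is `√3 s/(r - a)`, at most `√3`
      -- because `a + s < 1 < r`.
      · have htan : Real.tan (2 * ((r : ℂ) - a + t * β)).arg ≤ Real.tan (Real.pi / 3) := by
          rw [Complex.tan_arg, him, hre', Real.tan_pi_div_three, ← ht, div_le_iff₀ (by linarith)]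
          nlinarith
        by_contra hcon
        push Not at hcon
        have hlt : (2 * ((r : ℂ) - a + t * β)).arg < Real.pi / 2 := by
          have := Complex.abs_arg_lt_pi_div_two_iff.2 (Or.inl hre)
          exact (abs_lt.1 this).2
        have := Real.tan_lt_tan_of_lt_of_lt_pi_div_two (x := Real.pi / 3)
          (by linarith) hlt (by push_cast at hcon; exact hcon)
        linarith
  constructor
  · rw [eta, hsq, hcube]
    have := Complex.pow_cpow_nat_inv (x := 2 * ((r : ℂ) - a + t * β)) (n := 3)
      (by norm_num) harg.1 harg.2
    rw [one_div]
    exact_mod_cast this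
  · intro h
    rw [h] at hre
    simp at hre

/-- The constant mode: the cubic formula returns the real root as `spuriousRoot` and the pair
in the unit disc as `pairRoot`. -/
theorem spuriousRoot_spec {Ω Γ : ℝ} (hΩ : 0 < Ω) (hΩ2 : Ω < 2) (hΓ : 0 < Γ) :
    ∃ (r a : ℝ) (β : ℂ), 1 < r ∧ spuriousRoot Ω Γ = r ∧
      pairRoot 1 Ω Γ = a + Complex.I * β ∧ pairRoot (-1) Ω Γ = a - Complex.I * β ∧
      (coeff2 0 Ω Γ : ℂ) = -(r + 2 * a) ∧
      (coeff1 0 Ω Γ : ℂ) = 2 * r * a + (a ^ 2 + β ^ 2) ∧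
      (coeff0 Γ : ℂ) = -r * (a ^ 2 + β ^ 2) ∧
      ‖(a : ℂ) + Complex.I * β‖ < 1 ∧ ‖(a : ℂ) - Complex.I * β‖ < 1 ∧
      ∀ x, 0 < x → charCubic 0 Ω Γ x ≤ 0 → x ≤ r := by
  obtain ⟨r, a, s, β, hs, hβ, ha, h2, h1, h0, hn1, hn2, hre, hlt⟩ :=
    exists_factorization (S := 0) hΩ hΓ (by nlinarith)
  have hr := hlt (charCubic_zero_one hΩ hΓ)
  obtain ⟨heta, hne⟩ := eta_eq hs hβ ha hr h2 h1 h0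
  have h3 : ((Real.sqrt 3 : ℝ) : ℂ) ^ 2 = 3 := by
    exact_mod_cast Real.sq_sqrt (by norm_num : (0 : ℝ) ≤ 3)
  have key : 6 * ((3 * (coeff1 0 Ω Γ : ℂ) - (coeff2 0 Ω Γ : ℂ) ^ 2)
      / (9 * eta (coeff2 0 Ω Γ) (coeff1 0 Ω Γ) (coeff0 Γ)))
      = -((r : ℂ) - a - (Real.sqrt 3 : ℝ) * β) / 3 := by
    -- `3c₁ - c₂²` is, up to sign, the product of the two resolvents `r - a ± √3 β`, so dividing by
    -- `eta` leaves the other one.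
    have e : 3 * (coeff1 0 Ω Γ : ℂ) - (coeff2 0 Ω Γ : ℂ) ^ 2
        = -((r : ℂ) - a - (Real.sqrt 3 : ℝ) * β) * (r - a + (Real.sqrt 3 : ℝ) * β) := by
      rw [h2, h1]
      linear_combination (-β ^ 2) * h3
    rw [heta, e]
    generalize (r : ℂ) - a + (Real.sqrt 3 : ℝ) * β = R at hne
    field_simp
    ring
  have hm : zetaMinus (coeff2 0 Ω Γ) (coeff1 0 Ω Γ) (coeff0 Γ) = 2 * ((r : ℂ) - a) / 3 := by
    rw [zetaMinus, key, heta]; ring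
  have hp : zetaPlus (coeff2 0 Ω Γ) (coeff1 0 Ω Γ) (coeff0 Γ)
      = 2 * (Real.sqrt 3 : ℝ) * β / 3 := by
    rw [zetaPlus, key, heta]; ring
  refine ⟨r, a, β, hr, ?_, ?_, ?_, h2, h1, h0, hn1, hn2, ?_⟩
  · rw [spuriousRoot, hm, h2]; ring
  · rw [pairRoot, hm, hp, h2]; linear_combination (Complex.I * β / 3) * h3
  · rw [pairRoot, hm, hp, h2]; linear_combination (-Complex.I * β / 3) * h3
  · intro x hx hx0
    by_contra hcon
    push Not at hcon
    -- Any real root of the pair is below `1 < r`, so the cubic is positive beyond `r`.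
    have hfac : (charCubic 0 Ω Γ x : ℂ) = (x - r) * ((x - a) ^ 2 + β ^ 2) := by
      rw [charCubic]; push_cast; rw [h2, h1, h0]; ring
    rcases hβ with hβ | ⟨hβ, has⟩
    · have : charCubic 0 Ω Γ x = (x - r) * ((x - a) ^ 2 + s ^ 2) := by
        rw [hβ] at hfac; exact_mod_cast hfac
      have : 0 < (x - r) * ((x - a) ^ 2 + s ^ 2) := by
        have h4 : 0 < x - r := by linarith
        have h5 : 0 < x - a := by linarith
        positivity
      linarith
    · have : charCubic 0 Ω Γ x = (x - r) * ((x - a) ^ 2 - s ^ 2) := by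
        rw [hβ, mul_pow, Complex.I_sq] at hfac
        have h' : (x - r) * ((x - a) ^ 2 - s ^ 2) = (x - r) * ((x - a) ^ 2 + -1 * s ^ 2) := by
          ring
        rw [h']; exact_mod_cast hfac
      have : 0 < (x - r) * ((x - a) ^ 2 - s ^ 2) := by
        have h4 : 0 < x - r := by linarith
        have h5 : 0 < (x - a) ^ 2 - s ^ 2 := by nlinarith
        positivity
      linarith

/-! ### Expansion of the spurious root -/

/-- Leading trapezoidal error: in the Taylor expansion all terms up to `Γ²` cancel, and the cubic
one is `1/4 - 1/6 = 1/12`. -/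
theorem abs_tanh_defect_le {Γ : ℝ} (hΓ : 0 ≤ Γ) (hΓ1 : Γ ≤ 1) :
    |Γ / 2 * (1 + Real.exp (-Γ)) - (1 - Real.exp (-Γ)) - Γ ^ 3 / 12| ≤ Γ ^ 4 := by
  have h := Real.exp_bound (x := -Γ) (by rw [abs_neg, abs_of_nonneg hΓ]; exact hΓ1)
    (n := 4) (by norm_num)
  rw [abs_neg, abs_of_nonneg hΓ] at h
  simp [Finset.sum_range_succ, Nat.factorial] at h
  rw [abs_le] at h ⊢
  have h4 : 0 ≤ Γ ^ 4 := by positivity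
  constructor <;> nlinarith

/-- The spurious root is `1 + x` with `0 ≤ x ≤ 4 Γ³` and `x = Γ³/12 + O(Γ⁴ + Γ⁷/Ω²)`. -/
theorem spuriousRoot_expansion {Ω Γ : ℝ} (hΩ : 0 < Ω) (hΩ2 : Ω < 2) (hΓ : 0 < Γ)
    (hΓ1 : Γ ≤ 1) :
    ∃ x : ℝ, spuriousRoot Ω Γ = ((1 + x : ℝ) : ℂ) ∧ 0 ≤ x ∧ x ≤ 4 * Γ ^ 3 ∧
      |x - Γ ^ 3 / 12| ≤ 80 * (Γ ^ 4 + Γ ^ 7 / Ω ^ 2) := by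
  obtain ⟨r, a, β, hr, hA, -, -, h2, h1, h0, -⟩ := spuriousRoot_spec hΩ hΩ2 hΓ
  have hroot : charCubic 0 Ω Γ r = 0 := by
    have : (charCubic 0 Ω Γ r : ℂ) = 0 := by
      rw [charCubic]; push_cast; rw [h2, h1, h0]; ring
    exact_mod_cast this
  have he1 : Real.exp (-Γ) < 1 := Real.exp_lt_one_iff.2 (by linarith)
  have he2 : 1 - Γ ≤ Real.exp (-Γ) := by linarith [Real.add_one_le_exp (-Γ)]
  have hg := abs_tanh_defect_le hΓ.le hΓ1
  rw [charCubic_eq] at hroot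
  set e := Real.exp (-Γ) with he
  set g := Γ / 2 * (1 + e) - (1 - e) with hgdef
  obtain ⟨x, rfl⟩ : ∃ x, r = 1 + x := ⟨r - 1, by ring⟩
  have hx : 0 < x := by linarith
  have hΩsq : 0 < Ω ^ 2 := by positivity
  -- Dividing the cubic equation at `1 + x` by `Ω²(1 + x)` gives `y + x(1 - Γ/2) = g`, with `y` of
  -- higher order.
  set y := x ^ 2 * (1 + x - e) / (Ω ^ 2 * (1 + x)) with hy
  have hy0 : 0 ≤ y := by
    have : 0 ≤ 1 + x - e := by linarith
    positivity
  have heq : y + x * (1 - Γ / 2) = g := by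
    have h1x : (1 + x) ≠ 0 := by positivity
    rw [hy, hgdef]
    field_simp
    linarith
  have h3 : Γ ^ 4 ≤ Γ ^ 3 := pow_le_pow_of_le_one hΓ.le hΓ1 (by norm_num)
  have hΓ3 : 0 < Γ ^ 3 := by positivity
  -- `y ≥ 0` and `Γ ≤ 1` give `x ≤ 2g ≤ (13/6)Γ³`.
  have hxle : x ≤ 4 * Γ ^ 3 := by
    have := (abs_le.1 hg).2
    nlinarith
  refine ⟨x, hA, hx.le, hxle, ?_⟩
  have hyle : y ≤ 80 * (Γ ^ 7 / Ω ^ 2) := by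
    have hΓ31 : Γ ^ 3 ≤ Γ := by
      simpa using pow_le_pow_of_le_one hΓ.le hΓ1 (by norm_num : 1 ≤ 3)
    calc y ≤ x ^ 2 * (1 + x - e) / Ω ^ 2 := by
          rw [hy]
          have : 0 ≤ 1 + x - e := by linarith
          gcongr
          exact le_mul_of_one_le_right hΩsq.le (by linarith)
      _ ≤ (4 * Γ ^ 3) ^ 2 * (5 * Γ) / Ω ^ 2 := by
          gcongr
          · linarith
          · linarith
      _ = 80 * (Γ ^ 7 / Ω ^ 2) := by ring
  have hxΓ : x * Γ ≤ 4 * Γ ^ 4 := by nlinarith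
  have hxΓ0 : 0 ≤ x * Γ := by positivity
  have h4 : 0 ≤ Γ ^ 4 := by positivity
  have h7 : 0 ≤ Γ ^ 7 / Ω ^ 2 := by positivity
  rw [abs_le] at hg ⊢
  constructor <;> nlinarith [hg.1, hg.2]

theorem norm_spuriousRoot_sub_le {Ω Γ : ℝ} (hΩ : 0 < Ω) (hΩ2 : Ω < 2) (hΓ : 0 < Γ)
    (hΓ1 : Γ ≤ 1) :
    ‖spuriousRoot Ω Γ - (1 + (Γ : ℂ) ^ 3 / 12)‖ ≤ 80 * (Γ ^ 4 + Γ ^ 7 / Ω ^ 2) := by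
  obtain ⟨x, hA, -, -, h⟩ := spuriousRoot_expansion hΩ hΩ2 hΓ hΓ1
  have : spuriousRoot Ω Γ - (1 + (Γ : ℂ) ^ 3 / 12) = ((x - Γ ^ 3 / 12 : ℝ) : ℂ) := by
    rw [hA]; push_cast; ring
  rw [this, Complex.norm_real, Real.norm_eq_abs]
  exact h

theorem abs_log_norm_spuriousRoot_le {Ω Γ : ℝ} (hΩ : 0 < Ω) (hΩ2 : Ω < 2) (hΓ : 0 < Γ)
    (hΓ1 : Γ ≤ 1) : |Real.log ‖spuriousRoot Ω Γ‖| ≤ 4 * Γ ^ 3 := by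
  obtain ⟨x, hA, hx0, hx, -⟩ := spuriousRoot_expansion hΩ hΩ2 hΓ hΓ1
  rw [hA, Complex.norm_real, Real.norm_of_nonneg (by linarith),
    abs_of_nonneg (Real.log_nonneg (by linarith))]
  linarith [Real.log_le_sub_one_of_pos (by linarith : 0 < 1 + x)]

theorem spuriousRoot_isBigO {Ω : ℝ} (hΩ : 0 < Ω) (hΩ2 : Ω < 2) :
    (fun Γ : ℝ => spuriousRoot Ω Γ - (1 + (Γ : ℂ) ^ 3 / 12))
      =O[𝓝[>] (0 : ℝ)] fun Γ : ℝ => Γ ^ 4 := by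
  refine IsBigO.of_bound (80 * (1 + 1 / Ω ^ 2)) ?_
  filter_upwards [Ioo_mem_nhdsGT (zero_lt_one' ℝ)] with Γ hΓ
  refine (norm_spuriousRoot_sub_le hΩ hΩ2 hΓ.1 hΓ.2.le).trans ?_
  have h : Γ ^ 7 ≤ Γ ^ 4 := pow_le_pow_of_le_one hΓ.1.le hΓ.2.le (by norm_num)
  have h0 : 0 < Γ ^ 4 := pow_pos hΓ.1 4
  rw [Real.norm_of_nonneg h0.le]
  calc 80 * (Γ ^ 4 + Γ ^ 7 / Ω ^ 2) ≤ 80 * (Γ ^ 4 + Γ ^ 4 / Ω ^ 2) := by gcongr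
    _ = _ := by ring

theorem plasmaNumber_sq {w2 : ℝ} (hw : 0 ≤ w2) (dt : ℝ) :
    plasmaNumber w2 dt ^ 2 = dt ^ 2 * w2 :=
  Real.sq_sqrt (by positivity)

theorem plasmaNumber_pos {w2 dt : ℝ} (hw : 0 < w2) (hdt : 0 < dt) : 0 < plasmaNumber w2 dt :=
  Real.sqrt_pos.2 (by positivity)

theorem eventually_small_numbers {w2 γ : ℝ} (hw : 0 < w2) (hγ : 0 < γ) :
    ∀ᶠ dt in 𝓝[>] (0 : ℝ), 0 < dt ∧ dt < 1 ∧ 0 < plasmaNumber w2 dt ∧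
      plasmaNumber w2 dt < 2 ∧ 0 < γ * dt ∧ γ * dt ≤ 1 := by
  have hδ : 0 < min 1 (min (1 / γ) (1 / w2)) := by positivity
  filter_upwards [Ioo_mem_nhdsGT hδ] with dt hdt
  obtain ⟨h0, hlt⟩ := hdt
  rw [lt_min_iff, lt_min_iff, lt_div_iff₀ hγ, lt_div_iff₀ hw] at hlt
  obtain ⟨h1, h2, h3⟩ := hlt
  refine ⟨h0, h1, plasmaNumber_pos hw h0, ?_, by positivity, by linarith⟩
  have := plasmaNumber_sq hw.le dt
  nlinarith

/-- Here `Ω` vanishes together with `Γ`, so the dependence on `Ω` in the error matters: `Γ⁷/Ω² =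
γ⁷Δt⁵/w` is still negligible. -/
theorem spuriousRoot_isBigO_dt {w2 γ : ℝ} (hw : 0 < w2) (hγ : 0 < γ) :
    (fun dt : ℝ => spuriousRoot (plasmaNumber w2 dt) (γ * dt)
      - (1 + ((γ * dt : ℝ) : ℂ) ^ 3 / 12)) =O[𝓝[>] (0 : ℝ)] fun dt : ℝ => dt ^ 4 := by
  refine IsBigO.of_bound (80 * (γ ^ 4 + γ ^ 7 / w2)) ?_
  filter_upwards [eventually_small_numbers hw hγ] with dt ⟨h0, h1, hΩ, hΩ2, hΓ, hΓ1⟩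
  refine (norm_spuriousRoot_sub_le hΩ hΩ2 hΓ hΓ1).trans ?_
  rw [plasmaNumber_sq hw.le, Real.norm_of_nonneg (by positivity)]
  have h : dt ^ 5 ≤ dt ^ 4 := pow_le_pow_of_le_one h0.le h1.le (by norm_num)
  calc 80 * ((γ * dt) ^ 4 + (γ * dt) ^ 7 / (dt ^ 2 * w2))
      = 80 * (γ ^ 4 * dt ^ 4 + γ ^ 7 / w2 * dt ^ 5) := by field_simp
    _ ≤ 80 * (γ ^ 4 * dt ^ 4 + γ ^ 7 / w2 * dt ^ 4) := by gcongr
    _ = _ := by ring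

theorem growthRate_isBigO {w2 γ : ℝ} (hw : 0 < w2) (hγ : 0 < γ) :
    (fun dt : ℝ => Real.log ‖spuriousRoot (plasmaNumber w2 dt) (γ * dt)‖ / dt)
      =O[𝓝[>] (0 : ℝ)] fun dt : ℝ => dt ^ 2 := by
  refine IsBigO.of_bound (4 * γ ^ 3) ?_
  filter_upwards [eventually_small_numbers hw hγ] with dt ⟨h0, h1, hΩ, hΩ2, hΓ, hΓ1⟩
  have h := abs_log_norm_spuriousRoot_le hΩ hΩ2 hΓ hΓ1
  rw [norm_div, Real.norm_eq_abs, Real.norm_of_nonneg h0.le,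
    Real.norm_of_nonneg (by positivity), div_le_iff₀ h0]
  linarith [h, (by ring : 4 * (γ * dt) ^ 3 = 4 * γ ^ 3 * dt ^ 2 * dt)]

theorem growthRate_tendsto {w2 γ : ℝ} (hw : 0 < w2) (hγ : 0 < γ) :
    Tendsto (fun dt : ℝ => Real.log ‖spuriousRoot (plasmaNumber w2 dt) (γ * dt)‖ / dt)
      (𝓝[>] (0 : ℝ)) (𝓝 0) := by
  refine (growthRate_isBigO hw hγ).trans_tendsto ?_
  have : Tendsto (fun dt : ℝ => dt ^ 2) (𝓝 0) (𝓝 (0 ^ 2)) := (continuous_pow 2).tendsto 0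
  rw [zero_pow two_ne_zero] at this
  exact this.mono_left nhdsWithin_le_nhds

/-! ### Amplification factors of all wave numbers -/

theorem lapSymbol_nonneg {D : ℕ} (c dt : ℝ) (h ξ : Fin D → ℝ) : 0 ≤ lapSymbol c dt h ξ :=
  Finset.sum_nonneg fun _ _ => by positivity

theorem cflNumber_sq {D : ℕ} (c dt : ℝ) (h : Fin D → ℝ) :
    cflNumber c dt h ^ 2 = ∑ d, (c * dt / h d) ^ 2 := by
  rw [cflNumber, mul_pow, Real.sq_sqrt (Finset.sum_nonneg fun _ _ => by positivity),
    Finset.mul_sum]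
  exact Finset.sum_congr rfl fun _ _ => by ring

theorem lapSymbol_le {D : ℕ} (c dt : ℝ) (h ξ : Fin D → ℝ) :
    lapSymbol c dt h ξ ≤ 4 * cflNumber c dt h ^ 2 := by
  rw [cflNumber_sq, Finset.mul_sum]
  exact Finset.sum_le_sum fun d _ =>
    mul_le_of_le_one_right (by positivity) (Real.sin_sq_le_one _)

theorem cflNumber_nonneg {D : ℕ} {c dt : ℝ} (hc : 0 ≤ c) (hdt : 0 ≤ dt) (h : Fin D → ℝ) :
    0 ≤ cflNumber c dt h := by
  unfold cflNumber
  positivity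

theorem det_ampMatrix_eq_of_coeffs {S Ω Γ : ℝ} {r a β : ℂ}
    (h2 : (coeff2 S Ω Γ : ℂ) = -(r + 2 * a))
    (h1 : (coeff1 S Ω Γ : ℂ) = 2 * r * a + (a ^ 2 + β ^ 2))
    (h0 : (coeff0 Γ : ℂ) = -r * (a ^ 2 + β ^ 2)) (A : ℂ) :
    (ampMatrix S Ω Γ A).det = (A - r) * (A - (a + Complex.I * β)) * (A - (a - Complex.I * β)) := by
  rw [det_ampMatrix, h2, h1, h0]
  linear_combination ((A - r) * β ^ 2) * Complex.I_sq

/-- The amplification factors of a mode with nonnegative symbol `S`. -/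
theorem amplification_factors {S Ω Γ : ℝ} (hS0 : 0 ≤ S) (hΩ : 0 < Ω) (hΓ : 0 < Γ)
    (hS : S + Ω ^ 2 < 4) :
    ∃ (A₀ : ℝ) (Ap Am : ℂ),
      (∀ A : ℂ, (ampMatrix S Ω Γ A).det = (A - (A₀ : ℂ)) * (A - Ap) * (A - Am)) ∧
      ‖Ap‖ < 1 ∧ ‖Am‖ < 1 ∧ 0 < A₀ ∧ A₀ ≤ (spuriousRoot Ω Γ).re := by
  obtain ⟨r, a, s, β, -, -, -, h2, h1, h0, hn1, hn2, her, -⟩ :=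
    exists_factorization hΩ hΓ hS
  obtain ⟨r₀, -, -, hr₀, hA, -, -, -, -, -, -, -, hle⟩ :=
    spuriousRoot_spec hΩ (by nlinarith) hΓ
  have hrpos : 0 < r := (Real.exp_pos _).trans her
  refine ⟨r, _, _, det_ampMatrix_eq_of_coeffs h2 h1 h0, hn1, hn2, hrpos, ?_⟩
  rw [hA, Complex.ofReal_re]
  apply hle r hrpos
  have hroot : charCubic S Ω Γ r = 0 := by
    have : (charCubic S Ω Γ r : ℂ) = 0 := by
      rw [charCubic]; push_cast; rw [h2, h1, h0]; ring
    exact_mod_cast this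
  -- The cubic increases with `S` to the right of `e^{-Γ}`, so the constant-mode cubic is
  -- nonpositive at `r`, which therefore lies at or below its largest root.
  have hdiff : charCubic S Ω Γ r - charCubic 0 Ω Γ r = S * (r * (r - Real.exp (-Γ))) := by
    rw [charCubic_eq, charCubic_eq]; ring
  have : 0 ≤ S * (r * (r - Real.exp (-Γ))) :=
    mul_nonneg hS0 (mul_nonneg hrpos.le (by linarith))
  linarith

/-! ### Discrete Gronwall estimates -/

open scoped RealInnerProductSpace

/-- The implicit step is solved with `(1 + x)/(1 - x) ≤ 1 + 4x`, valid for `0 ≤ x ≤ 1/2`. -/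
theorem discrete_gronwall {G : ℕ → ℝ} {x : ℝ} (hx : 0 ≤ x) (hx2 : x ≤ 1 / 2)
    (hG : ∀ n, 0 ≤ G n) (h : ∀ n, G (n + 1) ≤ G n + x * (G n + G (n + 1))) (n : ℕ) :
    G n ≤ Real.exp (4 * (n * x)) * G 0 := by
  induction n with
  | zero => simp
  | succ n ih =>
    have h1 : (1 - x) * G (n + 1) ≤ (1 - x) * ((1 + 4 * x) * G n) := by
      nlinarith [h n, mul_nonneg (mul_nonneg hx (by linarith : 0 ≤ 1 - 2 * x)) (hG n)]
    have h2 : G (n + 1) ≤ (1 + 4 * x) * G n := le_of_mul_le_mul_left h1 (by linarith)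
    have h3 : 1 + 4 * x ≤ Real.exp (4 * x) := by
      linarith [Real.add_one_le_exp (4 * x)]
    calc G (n + 1) ≤ (1 + 4 * x) * G n := h2
      _ ≤ Real.exp (4 * x) * (Real.exp (4 * (n * x)) * G 0) :=
          mul_le_mul h3 ih (hG n) (Real.exp_pos _).le
      _ = Real.exp (4 * ((n + 1 : ℕ) * x)) * G 0 := by
          rw [← mul_assoc, ← Real.exp_add]; congr 2; push_cast; ring

/-- Growth of an energy coupled to two lower-order quantities. -/
theorem coupled_growth {p a b En : ℕ → ℝ} {κ M dt : ℝ} (hκ : 0 < κ) (hκ1 : κ ≤ 1)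
    (hM : 0 ≤ M) (hdt : 0 ≤ dt) (hsmall : 36 * M / κ * dt ≤ 1 / 2)
    (hp : ∀ n, 0 ≤ p n) (ha : ∀ n, 0 ≤ a n) (hb : ∀ n, 0 ≤ b n)
    (hEn : ∀ n, κ * p n ^ 2 ≤ En n)
    (hE : ∀ n, En (n + 1) ≤ En n + M * dt * ((a (n + 1) + b (n + 1)) * (p n + p (n + 1))))
    (ha' : ∀ n, a (n + 1)
      ≤ a n + M * dt * (p n + p (n + 1) + a n + a (n + 1) + b n + b (n + 1)))
    (hb' : ∀ n, b (n + 1)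
      ≤ b n + M * dt * (p n + p (n + 1) + a n + a (n + 1) + b n + b (n + 1))) (n : ℕ) :
    En n + a n ^ 2 + b n ^ 2
      ≤ Real.exp (4 * (n * (36 * M / κ * dt))) * (En 0 + a 0 ^ 2 + b 0 ^ 2) := by
  have hEn0 : ∀ n, 0 ≤ En n := fun n => le_trans (by have := hp n; positivity) (hEn n)
  refine discrete_gronwall (G := fun n => En n + a n ^ 2 + b n ^ 2)
    (by positivity) hsmall (fun n => ?_) (fun n => ?_) n
  · have := hEn0 n
    positivity
  · have hMdt : 0 ≤ M * dt := by positivity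
    set s := p n + p (n + 1) + a n + a (n + 1) + b n + b (n + 1) with hs
    have p0 := hp n
    have p1 := hp (n + 1)
    have a0 := ha n
    have a1 := ha (n + 1)
    have b0 := hb n
    have b1 := hb (n + 1)
    have hs0 : 0 ≤ s := by positivity
    have k1 : (a (n + 1) + b (n + 1)) * (p n + p (n + 1)) ≤ s * s :=
      mul_le_mul (by linarith) (by linarith) (by positivity) hs0
    have k1' : En (n + 1) ≤ En n + M * dt * (s * s) :=
      (hE n).trans (by gcongr)
    have k2 : a (n + 1) ^ 2 - a n ^ 2 ≤ M * dt * (s * s) := by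
      have : (a (n + 1) - a n) * (a (n + 1) + a n) ≤ M * dt * s * s :=
        mul_le_mul (by linarith [ha' n]) (by linarith) (by positivity) (by positivity)
      linarith
    have k3 : b (n + 1) ^ 2 - b n ^ 2 ≤ M * dt * (s * s) := by
      have : (b (n + 1) - b n) * (b (n + 1) + b n) ≤ M * dt * s * s :=
        mul_le_mul (by linarith [hb' n]) (by linarith) (by positivity) (by positivity)
      linarith
    have hss : s * s ≤ 6 * (p n ^ 2 + p (n + 1) ^ 2 + a n ^ 2 + a (n + 1) ^ 2
        + b n ^ 2 + b (n + 1) ^ 2) := by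
      rw [hs]
      linarith [sq_nonneg (p n - p (n + 1)), sq_nonneg (p n - a n),
        sq_nonneg (p n - a (n + 1)), sq_nonneg (p n - b n), sq_nonneg (p n - b (n + 1)),
        sq_nonneg (p (n + 1) - a n), sq_nonneg (p (n + 1) - a (n + 1)),
        sq_nonneg (p (n + 1) - b n), sq_nonneg (p (n + 1) - b (n + 1)),
        sq_nonneg (a n - a (n + 1)), sq_nonneg (a n - b n), sq_nonneg (a n - b (n + 1)),
        sq_nonneg (a (n + 1) - b n), sq_nonneg (a (n + 1) - b (n + 1)),
        sq_nonneg (b n - b (n + 1))]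
    have hκs : κ * (s * s) ≤ 6 * ((En n + a n ^ 2 + b n ^ 2)
        + (En (n + 1) + a (n + 1) ^ 2 + b (n + 1) ^ 2)) := by
      have t1 : κ * a n ^ 2 ≤ a n ^ 2 := mul_le_of_le_one_left (by positivity) hκ1
      have t2 : κ * a (n + 1) ^ 2 ≤ a (n + 1) ^ 2 := mul_le_of_le_one_left (by positivity) hκ1
      have t3 : κ * b n ^ 2 ≤ b n ^ 2 := mul_le_of_le_one_left (by positivity) hκ1
      have t4 : κ * b (n + 1) ^ 2 ≤ b (n + 1) ^ 2 := mul_le_of_le_one_left (by positivity) hκ1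
      have := mul_le_mul_of_nonneg_left hss hκ.le
      linarith [hEn n, hEn (n + 1)]
    have hfin : M * dt * (s * s) ≤ M * dt / κ * (6 * ((En n + a n ^ 2 + b n ^ 2)
        + (En (n + 1) + a (n + 1) ^ 2 + b (n + 1) ^ 2))) := by
      calc M * dt * (s * s) = M * dt / κ * (κ * (s * s)) := by field_simp
        _ ≤ _ := mul_le_mul_of_nonneg_left hκs (by positivity)
    -- Each of the three quantities grows by at most `M dt s²`, and `s²` costs a factor `6/κ`; the
    -- total `18` is within `36`.
    have e : 36 * M / κ * dt = 36 * (M * dt / κ) := by ring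
    have hnn : 0 ≤ M * dt / κ * ((En n + a n ^ 2 + b n ^ 2)
        + (En (n + 1) + a (n + 1) ^ 2 + b (n + 1) ^ 2)) := by
      have := hEn0 n
      have := hEn0 (n + 1)
      positivity
    show En (n + 1) + a (n + 1) ^ 2 + b (n + 1) ^ 2 ≤ En n + a n ^ 2 + b n ^ 2
      + 36 * M / κ * dt * ((En n + a n ^ 2 + b n ^ 2)
        + (En (n + 1) + a (n + 1) ^ 2 + b (n + 1) ^ 2))
    rw [e]
    linarith

/-! ### Leapfrog energy in an inner product space -/

section Leapfrog

variable {H : Type*} [NormedAddCommGroup H] [InnerProductSpace ℝ H]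

/-- The divided time difference of a sequence. -/
def timeDiff (dt : ℝ) (U : ℕ → H) (n : ℕ) : H := dt⁻¹ • (U (n + 1) - U n)

/-- The conserved energy of the leapfrog scheme `U'' = -L U`. -/
def leapfrogEnergy (L : H →ₗ[ℝ] H) (dt : ℝ) (U : ℕ → H) (n : ℕ) : ℝ :=
  ‖timeDiff dt U n‖ ^ 2 + ⟪L (U n), U (n + 1)⟫

theorem smul_timeDiff {dt : ℝ} (hdt : dt ≠ 0) (U : ℕ → H) (n : ℕ) :
    dt • timeDiff dt U n = U (n + 1) - U n := by
  rw [timeDiff, smul_smul, mul_inv_cancel₀ hdt, one_smul]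

/-- The equation is tested with the centred difference `U (n+2) - U n`. By symmetry of `L` the
potential part telescopes, so only the work of `g` remains. -/
theorem leapfrogEnergy_succ {L : H →ₗ[ℝ] H} (hsym : L.IsSymmetric) {dt : ℝ} (hdt : dt ≠ 0)
    {U g : ℕ → H}
    (hU : ∀ n, U (n + 2) = (2 : ℝ) • U (n + 1) - U n + dt ^ 2 • (g (n + 1) - L (U (n + 1))))
    (n : ℕ) :
    leapfrogEnergy L dt U (n + 1) = leapfrogEnergy L dt U n
      + dt * ⟪g (n + 1), timeDiff dt U (n + 1) + timeDiff dt U n⟫ := by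
  have h0 := smul_timeDiff hdt U n
  have h1 := smul_timeDiff hdt U (n + 1)
  have hd : timeDiff dt U (n + 1) - timeDiff dt U n = dt • (g (n + 1) - L (U (n + 1))) := by
    have : dt • (timeDiff dt U (n + 1) - timeDiff dt U n)
        = dt • (dt • (g (n + 1) - L (U (n + 1)))) := by
      rw [smul_sub, h0, h1, hU n, smul_smul, ← pow_two]
      module
    exact smul_right_injective H hdt this
  have hsum : dt • (timeDiff dt U (n + 1) + timeDiff dt U n) = U (n + 2) - U n := by
    rw [smul_add, h0, h1]
    abel
  have hsq : ‖timeDiff dt U (n + 1)‖ ^ 2 - ‖timeDiff dt U n‖ ^ 2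
      = ⟪timeDiff dt U (n + 1) - timeDiff dt U n, timeDiff dt U (n + 1) + timeDiff dt U n⟫ := by
    rw [inner_sub_left, inner_add_right, inner_add_right, real_inner_self_eq_norm_sq,
      real_inner_self_eq_norm_sq, real_inner_comm (timeDiff dt U n)]
    ring
  have hL : ⟪L (U (n + 1)), U (n + 2)⟫ - ⟪L (U n), U (n + 1)⟫
      = dt * ⟪L (U (n + 1)), timeDiff dt U (n + 1) + timeDiff dt U n⟫ := by
    rw [hsym (U n), real_inner_comm (L (U (n + 1))) (U n), ← inner_sub_right, ← hsum,
      inner_smul_right]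
  rw [hd, inner_smul_left, inner_sub_left] at hsq
  simp only [conj_trivial] at hsq
  show ‖timeDiff dt U (n + 1)‖ ^ 2 + ⟪L (U (n + 1)), U (n + 2)⟫
    = ‖timeDiff dt U n‖ ^ 2 + ⟪L (U n), U (n + 1)⟫ + _
  linarith

/-- Completing the square at the midpoint isolates the one negative term, which the CFL bound
absorbs into `‖v‖²`. -/
theorem leapfrogEnergy_eq {L : H →ₗ[ℝ] H} (hsym : L.IsSymmetric) {dt : ℝ} (hdt : dt ≠ 0)
    (U : ℕ → H) (n : ℕ) :
    leapfrogEnergy L dt U n = ‖timeDiff dt U n‖ ^ 2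
      + ⟪L (U n + (dt / 2) • timeDiff dt U n), U n + (dt / 2) • timeDiff dt U n⟫
      - dt ^ 2 / 4 * ⟪L (timeDiff dt U n), timeDiff dt U n⟫ := by
  have h0 : U (n + 1) = U n + dt • timeDiff dt U n := by rw [smul_timeDiff hdt]; abel
  have hs : ⟪L (timeDiff dt U n), U n⟫ = ⟪L (U n), timeDiff dt U n⟫ := by
    rw [hsym, real_inner_comm]
  rw [leapfrogEnergy, h0]
  simp only [map_add, map_smul, inner_add_left, inner_add_right, inner_smul_left,
    inner_smul_right, conj_trivial, hs]
  ring

theorem norm_sq_timeDiff_le {L : H →ₗ[ℝ] H} (hsym : L.IsSymmetric)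
    {dt q : ℝ} (hdt : dt ≠ 0)
    (hcfl : ∀ x, dt ^ 2 * ⟪L x, x⟫ ≤ 4 * q * ‖x‖ ^ 2) (U : ℕ → H) (n : ℕ) :
    (1 - q) * ‖timeDiff dt U n‖ ^ 2
      + ⟪L (U n + (dt / 2) • timeDiff dt U n), U n + (dt / 2) • timeDiff dt U n⟫
      ≤ leapfrogEnergy L dt U n := by
  rw [leapfrogEnergy_eq hsym hdt]
  linarith [hcfl (timeDiff dt U n)]

theorem leapfrogEnergy_succ_le {L : H →ₗ[ℝ] H} (hsym : L.IsSymmetric) {dt : ℝ} (hdt : 0 < dt)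
    {U g : ℕ → H}
    (hU : ∀ n, U (n + 2) = (2 : ℝ) • U (n + 1) - U n + dt ^ 2 • (g (n + 1) - L (U (n + 1))))
    (n : ℕ) :
    leapfrogEnergy L dt U (n + 1) ≤ leapfrogEnergy L dt U n
      + dt * (‖g (n + 1)‖ * (‖timeDiff dt U n‖ + ‖timeDiff dt U (n + 1)‖)) := by
  rw [leapfrogEnergy_succ hsym hdt.ne' hU]
  gcongr
  calc _ ≤ ‖g (n + 1)‖ * ‖timeDiff dt U (n + 1) + timeDiff dt U n‖ := real_inner_le_norm _ _
    _ ≤ _ := by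
      gcongr
      rw [add_comm]
      exact norm_add_le _ _

/-- The abstract recursive convolution scheme. -/
structure IsAbstractSolution (L : H →ₗ[ℝ] H) (dt W e : ℝ) (u ψ : ℕ → H) : Prop where
  field : ∀ n, u (n + 2) = (2 : ℝ) • u (n + 1) - u n
    + dt ^ 2 • (W • ψ (n + 1) - L (u (n + 1)))
  conv : ∀ n, ψ (n + 1) = (dt / 2) • u (n + 1) + (dt / 2 * e) • u n + e • ψ n

theorem IsAbstractSolution.norm_conv_le {L : H →ₗ[ℝ] H} {dt W e : ℝ} {u ψ : ℕ → H}
    (h : IsAbstractSolution L dt W e u ψ) (hdt : 0 ≤ dt) (he : 0 ≤ e) (he1 : e ≤ 1) (n : ℕ) :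
    ‖ψ (n + 1)‖ ≤ ‖ψ n‖ + dt * (‖u n‖ + ‖u (n + 1)‖) := by
  rw [h.conv n]
  refine (norm_add₃_le ..).trans ?_
  rw [norm_smul, norm_smul, norm_smul, Real.norm_of_nonneg (by positivity),
    Real.norm_of_nonneg (by positivity), Real.norm_of_nonneg he]
  have h1 : e * ‖ψ n‖ ≤ ‖ψ n‖ := mul_le_of_le_one_left (norm_nonneg _) he1
  have h2 : e * (dt * ‖u n‖) ≤ dt * ‖u n‖ := mul_le_of_le_one_left (by positivity) he1
  have h3 : 0 ≤ dt * ‖u n‖ := by positivity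
  have h4 : 0 ≤ dt * ‖u (n + 1)‖ := by positivity
  nlinarith

/-- Growth of the leapfrog energy together with the lower-order terms. -/
theorem IsAbstractSolution.energy_growth {L : H →ₗ[ℝ] H} {dt W e q : ℝ} {u ψ : ℕ → H}
    (h : IsAbstractSolution L dt W e u ψ) (hsym : L.IsSymmetric) (hpos : ∀ x, 0 ≤ ⟪L x, x⟫)
    (hdt : 0 < dt) (hW : 0 ≤ W) (he : 0 ≤ e) (he1 : e ≤ 1) (hq : 0 ≤ q) (hq1 : q < 1)
    (hcfl : ∀ x, dt ^ 2 * ⟪L x, x⟫ ≤ 4 * q * ‖x‖ ^ 2)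
    (hsmall : 36 * (1 + W) / (1 - q) * dt ≤ 1 / 2) (n : ℕ) :
    leapfrogEnergy L dt u n + ‖u n‖ ^ 2 + ‖ψ n‖ ^ 2
      ≤ Real.exp (4 * (n * (36 * (1 + W) / (1 - q) * dt)))
        * (leapfrogEnergy L dt u 0 + ‖u 0‖ ^ 2 + ‖ψ 0‖ ^ 2) := by
  have hMdt : dt ≤ (1 + W) * dt := le_mul_of_one_le_left hdt.le (by linarith)
  refine coupled_growth (p := fun n => ‖timeDiff dt u n‖) (a := fun n => ‖u n‖)
    (b := fun n => ‖ψ n‖) (En := leapfrogEnergy L dt u) (κ := 1 - q) (M := 1 + W)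
    (by linarith) (by linarith) (by linarith) hdt.le hsmall (fun _ => norm_nonneg _)
    (fun _ => norm_nonneg _) (fun _ => norm_nonneg _) (fun n => ?_) (fun n => ?_)
    (fun n => ?_) (fun n => ?_) n
  · linarith [norm_sq_timeDiff_le hsym hdt.ne' hcfl u n,
      hpos (u n + (dt / 2) • timeDiff dt u n)]
  · refine (leapfrogEnergy_succ_le (g := fun n => W • ψ n) hsym hdt h.field n).trans ?_
    rw [norm_smul, Real.norm_of_nonneg hW, mul_comm (1 + W) dt, mul_assoc]
    have : W * ‖ψ (n + 1)‖ ≤ (1 + W) * (‖u (n + 1)‖ + ‖ψ (n + 1)‖) := by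
      gcongr <;> linarith [norm_nonneg (u (n + 1))]
    have := mul_le_mul_of_nonneg_right this
      (by positivity : 0 ≤ ‖timeDiff dt u n‖ + ‖timeDiff dt u (n + 1)‖)
    have := mul_le_mul_of_nonneg_left this hdt.le
    linarith
  · have h0 : u (n + 1) = u n + dt • timeDiff dt u n := by rw [smul_timeDiff hdt.ne']; abel
    have h1 : ‖u (n + 1)‖ ≤ ‖u n‖ + dt * ‖timeDiff dt u n‖ := by
      conv_lhs => rw [h0]
      refine (norm_add_le _ _).trans ?_
      rw [norm_smul, Real.norm_of_nonneg hdt.le]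
    refine h1.trans ?_
    gcongr
    have := norm_nonneg (timeDiff dt u (n + 1))
    have := norm_nonneg (u n)
    have := norm_nonneg (u (n + 1))
    have := norm_nonneg (ψ n)
    have := norm_nonneg (ψ (n + 1))
    linarith
  · refine (h.norm_conv_le hdt.le he he1 n).trans ?_
    have := norm_nonneg (timeDiff dt u (n + 1))
    have := norm_nonneg (timeDiff dt u n)
    have := norm_nonneg (ψ n)
    have := norm_nonneg (ψ (n + 1))
    exact add_le_add le_rfl (mul_le_mul hMdt (by linarith) (by positivity) (by positivity))

/-- The time integral of the scheme is again a leapfrog scheme; its energy controls the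
field without derivatives of the data. -/
theorem IsAbstractSolution.integrated_growth {L : H →ₗ[ℝ] H} {dt W e q : ℝ} {u ψ : ℕ → H}
    (h : IsAbstractSolution L dt W e u ψ) (hsym : L.IsSymmetric) (hpos : ∀ x, 0 ≤ ⟪L x, x⟫)
    (hdt : 0 < dt) (hW : 0 ≤ W) (he : 0 ≤ e) (he1 : e ≤ 1) (hq : 0 ≤ q) (hq1 : q < 1)
    (hcfl : ∀ x, dt ^ 2 * ⟪L x, x⟫ ≤ 4 * q * ‖x‖ ^ 2)
    (hsmall : 36 * (1 + W) / (1 - q) * dt ≤ 1 / 2) (n : ℕ) :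
    (1 - q) * ‖u (n + 1)‖ ^ 2 + ‖ψ (n + 1)‖ ^ 2
      ≤ Real.exp (4 * (n * (36 * (1 + W) / (1 - q) * dt)))
        * (‖u 1‖ ^ 2 + ‖timeDiff dt u 0‖ ^ 2 + ‖ψ 1‖ ^ 2) := by
  have hMdt : dt ≤ (1 + W) * dt := le_mul_of_one_le_left hdt.le (by linarith)
  -- The sum starts at `u 1`, so that `U 0 = 0` and the velocity of `U` at level `n` is `u (n + 1)`:
  -- the initial energy is `‖u 1‖²`, free of `L`.
  set U : ℕ → H := fun n => dt • ∑ k ∈ Finset.range n, u (k + 1) with hUdef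
  set φ : ℕ → H := fun n => timeDiff dt u 0 + dt • ∑ k ∈ Finset.range n, W • ψ (k + 1)
    with hφdef
  have hUs : ∀ n, U (n + 1) = U n + dt • u (n + 1) := fun n => by
    simp only [hUdef, Finset.sum_range_succ, smul_add]
  have hφs : ∀ n, φ (n + 1) = φ n + dt • W • ψ (n + 1) := fun n => by
    simp only [hφdef, Finset.sum_range_succ, smul_add, add_assoc]
  -- The scheme summed once: a first-order recursion whose constant of summation, the initial
  -- velocity, sits in `φ`.
  have hfirst : ∀ n, u (n + 1) = u n + dt • (φ n - L (U n)) := by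
    intro n
    induction n with
    | zero =>
      simp only [hUdef, hφdef, Finset.range_zero, Finset.sum_empty, smul_zero, map_zero,
        add_zero, sub_zero, zero_add]
      rw [smul_timeDiff hdt.ne']
      abel
    | succ n ih =>
      rw [h.field n, hUs, hφs, map_add, L.map_smul dt (u (n + 1))]
      have ih' : dt • (φ n - L (U n)) = u (n + 1) - u n := by
        rw [ih, add_sub_cancel_left]
      have key : u (n + 1) + dt • (φ n + dt • W • ψ (n + 1) - (L (U n) + dt • L (u (n + 1))))
          = u (n + 1) + dt • (φ n - L (U n)) + dt ^ 2 • (W • ψ (n + 1) - L (u (n + 1))) := by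
        module
      rw [key, ih']
      module
  have hU : ∀ n, U (n + 2) = (2 : ℝ) • U (n + 1) - U n
      + dt ^ 2 • (φ (n + 1) - L (U (n + 1))) := by
    intro n
    rw [hUs (n + 1), hfirst (n + 1), eq_sub_of_add_eq (hUs n).symm]
    module
  have hv : ∀ n, timeDiff dt U n = u (n + 1) := fun n => by
    rw [timeDiff, hUs, add_sub_cancel_left, smul_smul, inv_mul_cancel₀ hdt.ne', one_smul]
  have hE0 : leapfrogEnergy L dt U 0 = ‖u 1‖ ^ 2 := by
    rw [leapfrogEnergy, hv]
    simp [hUdef]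
  have hφ0 : φ 0 = timeDiff dt u 0 := by simp [hφdef]
  have hlow : ∀ n, (1 - q) * ‖u (n + 1)‖ ^ 2 ≤ leapfrogEnergy L dt U n := fun n => by
    have := norm_sq_timeDiff_le hsym hdt.ne' hcfl U n
    have h2 := hpos (U n + (dt / 2) • timeDiff dt U n)
    rw [hv] at this h2
    linarith
  have hgrow := coupled_growth (p := fun n => ‖u (n + 1)‖) (a := fun n => ‖φ n‖)
    (b := fun n => ‖ψ (n + 1)‖) (En := leapfrogEnergy L dt U) (κ := 1 - q) (M := 1 + W)
    (by linarith) (by linarith) (by linarith) hdt.le hsmall (fun _ => norm_nonneg _)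
    (fun _ => norm_nonneg _) (fun _ => norm_nonneg _) hlow (fun n => ?_)
    (fun n => ?_) (fun n => ?_) n
  · rw [hE0, hφ0] at hgrow
    have := hlow n
    have : 0 ≤ ‖φ n‖ ^ 2 := by positivity
    linarith
  · refine (leapfrogEnergy_succ_le hsym hdt hU n).trans ?_
    rw [hv, hv]
    gcongr
    exact le_add_of_nonneg_right (norm_nonneg _)
  · rw [hφs n]
    refine (norm_add_le _ _).trans ?_
    rw [norm_smul, norm_smul, Real.norm_of_nonneg hdt.le, Real.norm_of_nonneg hW, ← hφs n]
    have h1 : dt * (W * ‖ψ (n + 1)‖) ≤ (1 + W) * dt * ‖ψ (n + 1)‖ := by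
      rw [← mul_assoc, mul_comm dt W]
      gcongr
      linarith
    refine add_le_add le_rfl (h1.trans ?_)
    gcongr
    have := norm_nonneg (u (n + 1))
    have := norm_nonneg (u (n + 2))
    have := norm_nonneg (φ n)
    have := norm_nonneg (φ (n + 1))
    have := norm_nonneg (ψ (n + 2))
    show _ ≤ ‖u (n + 1)‖ + ‖u (n + 2)‖ + ‖φ n‖ + ‖φ (n + 1)‖ + ‖ψ (n + 1)‖ + ‖ψ (n + 2)‖
    linarith
  · refine (h.norm_conv_le hdt.le he he1 (n + 1)).trans ?_
    have := norm_nonneg (φ n)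
    have := norm_nonneg (φ (n + 1))
    have := norm_nonneg (ψ (n + 1))
    have := norm_nonneg (ψ (n + 2))
    exact add_le_add le_rfl (mul_le_mul hMdt (by linarith) (by positivity) (by positivity))

end Leapfrog

/-! ### The scheme on square-summable grid fields -/

/-- The Hilbert space of square-summable grid fields. -/
abbrev GridL2 (D : ℕ) : Type := lp (fun _ : Fin D → ℤ => EuclideanSpace ℝ (Fin 3)) 2

theorem memℓp_iff_sqSummable {D : ℕ} {u : GridField D} : Memℓp u 2 ↔ SqSummable u := by
  rw [memℓp_gen_iff (by norm_num), SqSummable]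
  simp

theorem norm_sq_eq_tsum {D : ℕ} (f : GridL2 D) : ‖f‖ ^ 2 = ∑' j, ‖f j‖ ^ 2 := by
  have := lp.norm_rpow_eq_tsum (p := 2) (by norm_num) f
  simpa using this

theorem l2Norm_sq {D : ℕ} {h : Fin D → ℝ} (hh : ∀ d, 0 < h d) {u : GridField D}
    {f : GridL2 D} (hf : ∀ j, f j = u j) : l2Norm h u ^ 2 = (∏ d, h d) * ‖f‖ ^ 2 := by
  have hV : 0 < ∏ d, h d := Finset.prod_pos fun d _ => hh d
  rw [l2Norm, norm_sq_eq_tsum]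
  simp only [hf]
  rw [Real.sq_sqrt (mul_nonneg hV.le (tsum_nonneg fun _ => by positivity))]

/-- Reindexing of square-summable grid fields. -/
def reindexL2 {D : ℕ} (e : (Fin D → ℤ) ≃ (Fin D → ℤ)) : GridL2 D →ₗ[ℝ] GridL2 D where
  toFun f := ⟨fun j => f (e j), memℓp_iff_sqSummable.2
    (e.summable_iff.2 (memℓp_iff_sqSummable.1 (lp.memℓp f)))⟩
  map_add' _ _ := rfl
  map_smul' _ _ := rfl

theorem reindexL2_apply {D : ℕ} (e : (Fin D → ℤ) ≃ (Fin D → ℤ)) (f : GridL2 D)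
    (j : Fin D → ℤ) : reindexL2 e f j = f (e j) := rfl

theorem inner_reindexL2 {D : ℕ} (e : (Fin D → ℤ) ≃ (Fin D → ℤ)) (f g : GridL2 D) :
    ⟪reindexL2 e f, reindexL2 e g⟫ = ⟪f, g⟫ := by
  rw [lp.inner_eq_tsum, lp.inner_eq_tsum]
  exact e.tsum_eq fun j => ⟪f j, g j⟫

theorem norm_reindexL2 {D : ℕ} (e : (Fin D → ℤ) ≃ (Fin D → ℤ)) (f : GridL2 D) :
    ‖reindexL2 e f‖ = ‖f‖ := by
  rw [norm_eq_sqrt_real_inner, inner_reindexL2, ← norm_eq_sqrt_real_inner]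

theorem reindexL2_symm_apply {D : ℕ} (e : (Fin D → ℤ) ≃ (Fin D → ℤ)) (f : GridL2 D) :
    reindexL2 e (reindexL2 e.symm f) = f := by
  ext j : 2
  rw [reindexL2_apply, reindexL2_apply, e.symm_apply_apply]

theorem inner_reindexL2_right {D : ℕ} (e : (Fin D → ℤ) ≃ (Fin D → ℤ)) (f g : GridL2 D) :
    ⟪f, reindexL2 e g⟫ = ⟪reindexL2 e.symm f, g⟫ := by
  conv_lhs => rw [← reindexL2_symm_apply e f]
  exact inner_reindexL2 e _ _

/-- Translation of the grid by one cell in direction `d`. -/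
def cellShift {D : ℕ} (d : Fin D) : (Fin D → ℤ) ≃ (Fin D → ℤ) := Equiv.addRight (Pi.single d 1)

/-- The forward difference on square-summable grid fields. -/
def dPlusL2 {D : ℕ} (h : Fin D → ℝ) (d : Fin D) : GridL2 D →ₗ[ℝ] GridL2 D :=
  (h d)⁻¹ • (reindexL2 (cellShift d) - LinearMap.id)

/-- The backward difference on square-summable grid fields. -/
def dMinusL2 {D : ℕ} (h : Fin D → ℝ) (d : Fin D) : GridL2 D →ₗ[ℝ] GridL2 D :=
  (h d)⁻¹ • (LinearMap.id - reindexL2 (cellShift d).symm)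

theorem dPlusL2_apply {D : ℕ} (h : Fin D → ℝ) (d : Fin D) {f : GridL2 D} {u : GridField D}
    (hf : ∀ j, f j = u j) (j : Fin D → ℤ) : dPlusL2 h d f j = dPlus h d u j := by
  have : dPlusL2 h d f j = (h d)⁻¹ • (f (j + Pi.single d 1) - f j) := rfl
  rw [this, hf, hf, dPlus]

theorem dMinusL2_apply {D : ℕ} (h : Fin D → ℝ) (d : Fin D) {f : GridL2 D} {u : GridField D}
    (hf : ∀ j, f j = u j) (j : Fin D → ℤ) : dMinusL2 h d f j = dMinus h d u j := by
  have : dMinusL2 h d f j = (h d)⁻¹ • (f j - f (j + -Pi.single d 1)) := rfl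
  rw [this, hf, hf, dMinus, sub_eq_add_neg j]

/-- Summation by parts: translations are unitary, so the adjoint of the forward difference is minus
the backward one. -/
theorem inner_dPlusL2_dMinusL2 {D : ℕ} (h : Fin D → ℝ) (d : Fin D) (f g : GridL2 D) :
    ⟪dPlusL2 h d (dMinusL2 h d f), g⟫ = -⟪dPlusL2 h d f, dPlusL2 h d g⟫ := by
  simp only [dPlusL2, dMinusL2, LinearMap.smul_apply, LinearMap.sub_apply, LinearMap.id_apply,
    map_smul, map_sub, inner_smul_left, inner_smul_right, inner_sub_left, inner_sub_right,
    conj_trivial, reindexL2_symm_apply, inner_reindexL2]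
  rw [inner_reindexL2_right]
  ring

theorem norm_sq_dPlusL2_le {D : ℕ} (h : Fin D → ℝ) (d : Fin D) (f : GridL2 D) :
    ‖dPlusL2 h d f‖ ^ 2 ≤ 4 * (1 / h d ^ 2) * ‖f‖ ^ 2 := by
  have h1 : ‖reindexL2 (cellShift d) f - f‖ ≤ 2 * ‖f‖ := by
    refine (norm_sub_le _ _).trans ?_
    rw [norm_reindexL2]
    linarith
  have h2 : dPlusL2 h d f = (h d)⁻¹ • (reindexL2 (cellShift d) f - f) := rfl
  rw [h2, norm_smul, mul_pow, Real.norm_eq_abs, sq_abs]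
  calc (h d)⁻¹ ^ 2 * ‖reindexL2 (cellShift d) f - f‖ ^ 2 ≤ (h d)⁻¹ ^ 2 * (2 * ‖f‖) ^ 2 := by
        gcongr
    _ = _ := by rw [one_div, inv_pow]; ring

/-- The discrete Laplacian on square-summable grid fields. -/
def lapL2 {D : ℕ} (h : Fin D → ℝ) : GridL2 D →ₗ[ℝ] GridL2 D :=
  ∑ d, dPlusL2 h d ∘ₗ dMinusL2 h d

theorem lapL2_apply {D : ℕ} (h : Fin D → ℝ) {f : GridL2 D} {u : GridField D}
    (hf : ∀ j, f j = u j) (j : Fin D → ℤ) : lapL2 h f j = lap h u j := by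
  rw [lapL2, LinearMap.sum_apply, lp.coeFn_sum, Finset.sum_apply, lap]
  exact Finset.sum_congr rfl fun d _ => dPlusL2_apply h d (dMinusL2_apply h d hf) j

/-- The spatial operator `-c² Δ_h + w`. -/
def spatialOp {D : ℕ} (c w2 : ℝ) (h : Fin D → ℝ) : GridL2 D →ₗ[ℝ] GridL2 D :=
  w2 • LinearMap.id - c ^ 2 • lapL2 h

theorem inner_spatialOp {D : ℕ} (c w2 : ℝ) (h : Fin D → ℝ) (f g : GridL2 D) :
    ⟪spatialOp c w2 h f, g⟫ = w2 * ⟪f, g⟫ + c ^ 2 * ∑ d, ⟪dPlusL2 h d f, dPlusL2 h d g⟫ := by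
  simp only [spatialOp, lapL2, LinearMap.sub_apply, LinearMap.smul_apply, LinearMap.id_apply,
    inner_sub_left, inner_smul_left, conj_trivial, LinearMap.sum_apply, LinearMap.comp_apply,
    sum_inner, inner_dPlusL2_dMinusL2, Finset.sum_neg_distrib]
  ring

theorem inner_spatialOp_self {D : ℕ} (c w2 : ℝ) (h : Fin D → ℝ) (f : GridL2 D) :
    ⟪spatialOp c w2 h f, f⟫ = w2 * ‖f‖ ^ 2 + c ^ 2 * ∑ d, ‖dPlusL2 h d f‖ ^ 2 := by
  rw [inner_spatialOp]
  simp only [real_inner_self_eq_norm_sq]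

theorem spatialOp_isSymmetric {D : ℕ} (c w2 : ℝ) (h : Fin D → ℝ) :
    (spatialOp c w2 h).IsSymmetric := by
  intro f g
  rw [real_inner_comm, ← real_inner_comm f, inner_spatialOp, real_inner_comm,
    inner_spatialOp, real_inner_comm]
  simp only [real_inner_comm]

theorem sum_norm_sq_dPlusL2_le {D : ℕ} (h : Fin D → ℝ) (f : GridL2 D) :
    ∑ d, ‖dPlusL2 h d f‖ ^ 2 ≤ 4 * (∑ d, 1 / h d ^ 2) * ‖f‖ ^ 2 := by
  rw [Finset.mul_sum, Finset.sum_mul]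
  exact Finset.sum_le_sum fun d _ => norm_sq_dPlusL2_le h d f

/-- A square-summable grid field as an element of the Hilbert space. -/
def toGridL2 {D : ℕ} (u : GridField D) (hu : SqSummable u) : GridL2 D :=
  ⟨u, memℓp_iff_sqSummable.2 hu⟩

theorem toGridL2_apply {D : ℕ} (u : GridField D) (hu : SqSummable u) (j : Fin D → ℤ) :
    toGridL2 u hu j = u j := rfl

theorem sqSummable_of_eq {D : ℕ} {u : GridField D} (f : GridL2 D) (hf : ∀ j, f j = u j) :
    SqSummable u := by
  have h := memℓp_iff_sqSummable.1 (lp.memℓp f)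
  rwa [funext hf] at h

theorem IsSolution.sqSummable {D : ℕ} {c w2 γ dt : ℝ} {h : Fin D → ℝ} {E ψ : ℕ → GridField D}
    (hs : IsSolution c w2 γ dt h E ψ) (h0 : SqSummable (E 0)) (h1 : SqSummable (E 1))
    (h2 : SqSummable (ψ 0)) (n : ℕ) :
    SqSummable (E n) ∧ SqSummable (E (n + 1)) ∧ SqSummable (ψ n) := by
  induction n with
  | zero => exact ⟨h0, h1, h2⟩
  | succ n ih =>
    obtain ⟨k0, k1, k2⟩ := ih
    have k3 : SqSummable (ψ (n + 1)) :=
      sqSummable_of_eq ((dt / 2) • toGridL2 _ k1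
        + (dt / 2 * Real.exp (-(γ * dt))) • toGridL2 _ k0
        + Real.exp (-(γ * dt)) • toGridL2 _ k2) fun j => (hs.2 n j).symm
    refine ⟨k1, sqSummable_of_eq ((2 : ℝ) • toGridL2 _ k1 - toGridL2 _ k0
      + dt ^ 2 • (c ^ 2 • lapL2 h (toGridL2 _ k1) - w2 • toGridL2 _ k1
        + (w2 * γ) • toGridL2 _ k3)) fun j => ?_, k3⟩
    rw [hs.1 n j, ← lapL2_apply h (toGridL2_apply _ k1)]
    rfl

theorem IsSolution.exists_abstract {D : ℕ} {c w2 γ dt : ℝ} {h : Fin D → ℝ}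
    {E ψ : ℕ → GridField D} (hs : IsSolution c w2 γ dt h E ψ)
    (h0 : SqSummable (E 0)) (h1 : SqSummable (E 1)) (h2 : SqSummable (ψ 0)) :
    ∃ u φ : ℕ → GridL2 D, (∀ n j, u n j = E n j) ∧ (∀ n j, φ n j = ψ n j) ∧
      IsAbstractSolution (spatialOp c w2 h) dt (w2 * γ) (Real.exp (-(γ * dt))) u φ := by
  have hsum := hs.sqSummable h0 h1 h2
  refine ⟨fun n => toGridL2 (E n) (hsum n).1, fun n => toGridL2 (ψ n) (hsum n).2.2,
    fun _ _ => rfl, fun _ _ => rfl, fun n => ?_, fun n => ?_⟩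
  · ext j : 2
    rw [toGridL2_apply, hs.1 n j, ← lapL2_apply h (toGridL2_apply _ (hsum (n + 1)).1)]
    have e : ∀ a b d f g : EuclideanSpace ℝ (Fin 3), (2 : ℝ) • a - b
        + dt ^ 2 • (c ^ 2 • d - w2 • f + (w2 * γ) • g) = (2 : ℝ) • a - b
        + dt ^ 2 • ((w2 * γ) • g - (w2 • f - c ^ 2 • d)) := fun a b d f g => by module
    exact e _ _ _ _ _
  · ext j : 2
    exact hs.2 n j

theorem timeDiff_apply {D : ℕ} {dt : ℝ} {E : ℕ → GridField D} {u : ℕ → GridL2 D}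
    (hu : ∀ n j, u n j = E n j) (n : ℕ) (j : Fin D → ℤ) :
    timeDiff dt u n j = dt⁻¹ • (E (n + 1) j - E n j) := by
  rw [← hu, ← hu]
  rfl

section Norms

variable {D : ℕ} {dt : ℝ} {h : Fin D → ℝ} {E ψ : ℕ → GridField D} {u φ : ℕ → GridL2 D}

theorem energyNorm_sq (hh : ∀ d, 0 < h d) (hu : ∀ n j, u n j = E n j)
    (hφ : ∀ n j, φ n j = ψ n j) (n : ℕ) :
    energyNorm h (stateAt dt E ψ n) ^ 2 = (∏ d, h d) * (‖u n‖ ^ 2 + ‖timeDiff dt u n‖ ^ 2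
      + ∑ d, ‖dPlusL2 h d (u n)‖ ^ 2 + ‖φ n‖ ^ 2) := by
  rw [energyNorm, Real.sq_sqrt (by positivity)]
  simp only [stateAt]
  rw [l2Norm_sq hh (hu n), l2Norm_sq hh (timeDiff_apply hu n), l2Norm_sq hh (hφ n)]
  simp only [fun d => l2Norm_sq hh (dPlusL2_apply h d (hu n))]
  rw [← Finset.mul_sum]
  ring

theorem fieldNorm_sq (hh : ∀ d, 0 < h d) (hu : ∀ n j, u n j = E n j)
    (hφ : ∀ n j, φ n j = ψ n j) (n : ℕ) :
    fieldNorm h (stateAt dt E ψ n) ^ 2 = (∏ d, h d) * (‖u n‖ ^ 2 + ‖φ n‖ ^ 2) := by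
  rw [fieldNorm, Real.sq_sqrt (by positivity)]
  simp only [stateAt]
  rw [l2Norm_sq hh (hu n), l2Norm_sq hh (hφ n)]
  ring

theorem dataNorm_sq (hh : ∀ d, 0 < h d) (hu : ∀ n j, u n j = E n j)
    (hφ : ∀ n j, φ n j = ψ n j) (n : ℕ) :
    dataNorm h (stateAt dt E ψ n) ^ 2
      = (∏ d, h d) * (‖u n‖ ^ 2 + ‖timeDiff dt u n‖ ^ 2 + ‖φ n‖ ^ 2) := by
  rw [dataNorm, Real.sq_sqrt (by positivity)]
  simp only [stateAt]
  rw [l2Norm_sq hh (hu n), l2Norm_sq hh (timeDiff_apply hu n), l2Norm_sq hh (hφ n)]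
  ring

end Norms

/-! ### From energy growth to stability in the discrete norms -/

/-- The operator bound is `Ω² + 4Λ²`. The hypothesis forces `Λ ≤ q < 1`, so `Λ² ≤ Λ` and the
condition linear in `Λ` suffices. -/
theorem spatialOp_cfl {D : ℕ} {c w2 dt q : ℝ} {h : Fin D → ℝ} (hc : 0 < c) (hw : 0 ≤ w2)
    (hdt : 0 < dt) (hq1 : q < 1)
    (hadm : cflNumber c dt h + plasmaNumber w2 dt ^ 2 / 4 ≤ q) (f : GridL2 D) :
    dt ^ 2 * ⟪spatialOp c w2 h f, f⟫ ≤ 4 * q * ‖f‖ ^ 2 := by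
  have hΛ := cflNumber_nonneg hc.le hdt.le h
  have hΩ := sq_nonneg (plasmaNumber w2 dt)
  have hΛ2 : cflNumber c dt h ^ 2 ≤ cflNumber c dt h := by nlinarith
  have hΛsq : cflNumber c dt h ^ 2 = c ^ 2 * dt ^ 2 * ∑ d, 1 / h d ^ 2 := by
    rw [cflNumber_sq, Finset.mul_sum]
    exact Finset.sum_congr rfl fun _ _ => by ring
  rw [inner_spatialOp_self]
  calc dt ^ 2 * (w2 * ‖f‖ ^ 2 + c ^ 2 * ∑ d, ‖dPlusL2 h d f‖ ^ 2)
      ≤ dt ^ 2 * (w2 * ‖f‖ ^ 2 + c ^ 2 * (4 * (∑ d, 1 / h d ^ 2) * ‖f‖ ^ 2)) := by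
        gcongr
        exact sum_norm_sq_dPlusL2_le h f
    _ = (plasmaNumber w2 dt ^ 2 + 4 * cflNumber c dt h ^ 2) * ‖f‖ ^ 2 := by
        rw [plasmaNumber_sq hw, hΛsq]; ring
    _ ≤ 4 * q * ‖f‖ ^ 2 := by
        gcongr
        linarith

/-- Stability follows from a growth bound for the squared norms of abstract solutions. -/
theorem finiteTimeStable_of_sq_bound {D : ℕ} {c w2 γ q C K : ℝ} (hc : 0 < c) (hw : 0 ≤ w2)
    (hq1 : q < 1) (hC : 0 < C) (hK : 1 ≤ K) {N N₀ : (Fin D → ℝ) → GridState D → ℝ}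
    (hN₀ : ∀ h s, 0 ≤ N₀ h s)
    (H : ∀ (dt : ℝ) (h : Fin D → ℝ), 0 < dt → dt ≤ 1 → C * dt ≤ 1 / 2 → (∀ d, 0 < h d) →
      0 ≤ q → (∀ f : GridL2 D, dt ^ 2 * ⟪spatialOp c w2 h f, f⟫ ≤ 4 * q * ‖f‖ ^ 2) →
      ∀ (E ψ : ℕ → GridField D) (u φ : ℕ → GridL2 D), (∀ n j, u n j = E n j) →
        (∀ n j, φ n j = ψ n j) →
        IsAbstractSolution (spatialOp c w2 h) dt (w2 * γ) (Real.exp (-(γ * dt))) u φ →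
        ∀ n : ℕ, N h (stateAt dt E ψ n) ^ 2
          ≤ K * Real.exp (4 * (n * (C * dt))) * N₀ h (stateAt dt E ψ 0) ^ 2) :
    FiniteTimeStable c w2 γ
      (fun dt h => cflNumber c dt h + plasmaNumber w2 dt ^ 2 / 4 ≤ q) N N₀ := by
  intro T _
  -- The bound `K·exp` on squares is weakened to `(K·exp)²`, as `K·exp ≥ 1`; no square roots of
  -- constants are needed. The choice of `δ` gives `dt ≤ 1` and `C dt ≤ 1/2`.
  refine ⟨K, 4 * C, min 1 (1 / (2 * C)), by linarith, by linarith, by positivity, ?_⟩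
  intro dt h hdt hdtδ hh _ hadm E ψ hs h0 h1 h2 n _
  have hsum := hs.sqSummable h0 h1 h2 n
  obtain ⟨u, φ, hu, hφ, habs⟩ := hs.exists_abstract h0 h1 h2
  rw [lt_min_iff, lt_div_iff₀ (by positivity)] at hdtδ
  have hq0 : 0 ≤ q :=
    le_trans (add_nonneg (cflNumber_nonneg hc.le hdt.le h) (by positivity)) hadm
  have hb := H dt h hdt hdtδ.1.le (by linarith) hh hq0 (spatialOp_cfl hc hw hdt hq1 hadm)
    E ψ u φ hu hφ habs n
  refine ⟨hsum.1, hsum.2.2, abs_le_of_sq_le_sq' ?_ ?_ |>.2⟩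
  · have e : 4 * ((n : ℝ) * (C * dt)) = 4 * C * (n * dt) := by ring
    rw [e] at hb
    refine hb.trans ?_
    rw [mul_pow]
    gcongr
    have : 1 ≤ Real.exp (4 * C * (n * dt)) := Real.one_le_exp (by positivity)
    exact le_self_pow₀ (by nlinarith) two_ne_zero
  · have := hN₀ h (stateAt dt E ψ 0)
    positivity

section Bounds

variable {D : ℕ} {c w2 dt W e q : ℝ} {h : Fin D → ℝ} {u φ : ℕ → GridL2 D}

theorem spatialOp_nonneg (hw : 0 ≤ w2) (f : GridL2 D) : 0 ≤ ⟪spatialOp c w2 h f, f⟫ := by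
  rw [inner_spatialOp_self]
  positivity

/-- Positivity of `L` at `u - dt v` bounds the cross term `dt⟪Lu, v⟫` by `½⟪Lu, u⟫ + ½dt²⟪Lv, v⟫`,
and the last term by `2q‖v‖²`. -/
theorem leapfrogEnergy_le (hw : 0 ≤ w2) (hdt : 0 < dt) (hq1 : q < 1)
    (hcfl : ∀ f : GridL2 D, dt ^ 2 * ⟪spatialOp c w2 h f, f⟫ ≤ 4 * q * ‖f‖ ^ 2) (n : ℕ) :
    leapfrogEnergy (spatialOp c w2 h) dt u n ≤ 3 * ‖timeDiff dt u n‖ ^ 2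
      + 3 / 2 * (w2 * ‖u n‖ ^ 2 + c ^ 2 * ∑ d, ‖dPlusL2 h d (u n)‖ ^ 2) := by
  have h0 : u (n + 1) = u n + dt • timeDiff dt u n := by rw [smul_timeDiff hdt.ne']; abel
  have hs : ⟪spatialOp c w2 h (timeDiff dt u n), u n⟫
      = ⟪spatialOp c w2 h (u n), timeDiff dt u n⟫ := by
    rw [spatialOp_isSymmetric, real_inner_comm]
  have hp := spatialOp_nonneg (c := c) (h := h) hw (u n - dt • timeDiff dt u n)
  rw [← inner_spatialOp_self, leapfrogEnergy, h0]
  simp only [map_sub, map_smul, inner_add_right, inner_sub_left, inner_sub_right,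
    inner_smul_left, inner_smul_right, conj_trivial, hs] at hp ⊢
  have := hcfl (timeDiff dt u n)
  have : 0 ≤ (1 - q) * ‖timeDiff dt u n‖ ^ 2 := mul_nonneg (by linarith) (by positivity)
  linarith

/-- The energy sees the gradient only at the midpoint `m`. Since `u = m - (dt/2)v`, the quadratic
form at `u` is at most twice that at `m` plus a multiple of `dt²⟪Lv, v⟫`, controlled by CFL and the
velocity bound. -/
theorem gradient_le_leapfrogEnergy (hw : 0 ≤ w2) (hdt : 0 < dt) (hq1 : q < 1)
    (hcfl : ∀ f : GridL2 D, dt ^ 2 * ⟪spatialOp c w2 h f, f⟫ ≤ 4 * q * ‖f‖ ^ 2) (n : ℕ) :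
    (1 - q) * ‖timeDiff dt u n‖ ^ 2 ≤ leapfrogEnergy (spatialOp c w2 h) dt u n ∧
    c ^ 2 * ∑ d, ‖dPlusL2 h d (u n)‖ ^ 2
      ≤ (2 + 2 / (1 - q)) * leapfrogEnergy (spatialOp c w2 h) dt u n := by
  have hlow := norm_sq_timeDiff_le (spatialOp_isSymmetric c w2 h) hdt.ne' hcfl u n
  set m := u n + (dt / 2) • timeDiff dt u n with hm
  have hm0 := spatialOp_nonneg (c := c) (h := h) hw m
  have hv : (1 - q) * ‖timeDiff dt u n‖ ^ 2 ≤ leapfrogEnergy (spatialOp c w2 h) dt u n := by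
    linarith
  have hv0 : 0 ≤ (1 - q) * ‖timeDiff dt u n‖ ^ 2 := mul_nonneg (by linarith) (by positivity)
  refine ⟨hv, ?_⟩
  have hun : u n = m - (dt / 2) • timeDiff dt u n := by rw [hm]; abel
  have hs : ⟪spatialOp c w2 h (timeDiff dt u n), m⟫
      = ⟪spatialOp c w2 h m, timeDiff dt u n⟫ := by
    rw [spatialOp_isSymmetric, real_inner_comm]
  have hp := spatialOp_nonneg (c := c) (h := h) hw (m + (dt / 2) • timeDiff dt u n)
  have hself := inner_spatialOp_self c w2 h (u n)
  have hB : ⟪spatialOp c w2 h (u n), u n⟫ ≤ 2 * ⟪spatialOp c w2 h m, m⟫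
      + dt ^ 2 / 2 * ⟪spatialOp c w2 h (timeDiff dt u n), timeDiff dt u n⟫ := by
    rw [hun]
    simp only [map_add, map_sub, map_smul, inner_add_left, inner_add_right, inner_sub_left,
      inner_sub_right, inner_smul_left, inner_smul_right, conj_trivial, hs] at hp ⊢
    linarith
  have hcv := hcfl (timeDiff dt u n)
  have hv' : ‖timeDiff dt u n‖ ^ 2
      ≤ leapfrogEnergy (spatialOp c w2 h) dt u n / (1 - q) := by
    rw [le_div_iff₀ (by linarith)]
    linarith
  have hqv : q * ‖timeDiff dt u n‖ ^ 2 ≤ ‖timeDiff dt u n‖ ^ 2 :=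
    mul_le_of_le_one_left (by positivity) hq1.le
  have hwu : 0 ≤ w2 * ‖u n‖ ^ 2 := by positivity
  have hexp : (2 + 2 / (1 - q)) * leapfrogEnergy (spatialOp c w2 h) dt u n
      = 2 * leapfrogEnergy (spatialOp c w2 h) dt u n
        + 2 * (leapfrogEnergy (spatialOp c w2 h) dt u n / (1 - q)) := by ring
  rw [hexp]
  linarith

/-- The first factor converts the leapfrog energy at level `n` into the energy norm; the second
bounds the initial energy by the data. -/
theorem energy_sq_bound (hc : 0 < c) (hw : 0 ≤ w2) (hW : 0 ≤ W) (he : 0 ≤ e) (he1 : e ≤ 1)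
    (hdt : 0 < dt) (hq : 0 ≤ q) (hq1 : q < 1)
    (hcfl : ∀ f : GridL2 D, dt ^ 2 * ⟪spatialOp c w2 h f, f⟫ ≤ 4 * q * ‖f‖ ^ 2)
    (hsmall : 36 * (1 + W) / (1 - q) * dt ≤ 1 / 2)
    (habs : IsAbstractSolution (spatialOp c w2 h) dt W e u φ) (n : ℕ) :
    ‖u n‖ ^ 2 + ‖timeDiff dt u n‖ ^ 2 + ∑ d, ‖dPlusL2 h d (u n)‖ ^ 2 + ‖φ n‖ ^ 2
      ≤ (1 + 1 / (1 - q) + (2 + 2 / (1 - q)) / c ^ 2) * (3 + 3 / 2 * w2 + 3 / 2 * c ^ 2)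
        * Real.exp (4 * (n * (36 * (1 + W) / (1 - q) * dt)))
        * (‖u 0‖ ^ 2 + ‖timeDiff dt u 0‖ ^ 2 + ∑ d, ‖dPlusL2 h d (u 0)‖ ^ 2
          + ‖φ 0‖ ^ 2) := by
  have hgrow := habs.energy_growth (spatialOp_isSymmetric c w2 h) (spatialOp_nonneg hw) hdt hW
    he he1 hq hq1 hcfl hsmall n
  have hupper := leapfrogEnergy_le (u := u) hw hdt hq1 hcfl 0
  obtain ⟨hv, hgrad⟩ := gradient_le_leapfrogEnergy (u := u) hw hdt hq1 hcfl n
  set En := leapfrogEnergy (spatialOp c w2 h) dt u n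
  set E0 := leapfrogEnergy (spatialOp c w2 h) dt u 0
  set X := Real.exp (4 * (n * (36 * (1 + W) / (1 - q) * dt)))
  have hX : 0 < X := Real.exp_pos _
  have h1q : 0 < 1 - q := by linarith
  have hc2 : 0 < c ^ 2 := by positivity
  have hE0 : 0 ≤ En := le_trans (by positivity) hv
  have hS0 : 0 ≤ ∑ d, ‖dPlusL2 h d (u 0)‖ ^ 2 := Finset.sum_nonneg fun _ _ => by positivity
  have hv' : ‖timeDiff dt u n‖ ^ 2 ≤ 1 / (1 - q) * En := by
    rw [one_div, ← div_eq_inv_mul, le_div_iff₀ h1q]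
    linarith
  have hgrad' : ∑ d, ‖dPlusL2 h d (u n)‖ ^ 2 ≤ (2 + 2 / (1 - q)) / c ^ 2 * En := by
    rw [div_mul_eq_mul_div, le_div_iff₀ hc2]
    linarith
  set K1 := 1 + 1 / (1 - q) + (2 + 2 / (1 - q)) / c ^ 2 with hK1
  have hK1' : 0 ≤ 1 / (1 - q) + (2 + 2 / (1 - q)) / c ^ 2 := by positivity
  have hleft : ‖u n‖ ^ 2 + ‖timeDiff dt u n‖ ^ 2 + ∑ d, ‖dPlusL2 h d (u n)‖ ^ 2 + ‖φ n‖ ^ 2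
      ≤ K1 * (En + ‖u n‖ ^ 2 + ‖φ n‖ ^ 2) := by
    have := mul_nonneg hK1' (by positivity : 0 ≤ ‖u n‖ ^ 2 + ‖φ n‖ ^ 2)
    rw [hK1]
    linarith
  have hright : E0 + ‖u 0‖ ^ 2 + ‖φ 0‖ ^ 2 ≤ (3 + 3 / 2 * w2 + 3 / 2 * c ^ 2)
      * (‖u 0‖ ^ 2 + ‖timeDiff dt u 0‖ ^ 2 + ∑ d, ‖dPlusL2 h d (u 0)‖ ^ 2 + ‖φ 0‖ ^ 2) := by
    have i1 : 0 ≤ w2 * (‖timeDiff dt u 0‖ ^ 2 + ∑ d, ‖dPlusL2 h d (u 0)‖ ^ 2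
      + ‖φ 0‖ ^ 2) := by positivity
    have i2 : 0 ≤ c ^ 2 * (‖u 0‖ ^ 2 + ‖timeDiff dt u 0‖ ^ 2 + ‖φ 0‖ ^ 2) := by positivity
    have i3 : 0 ≤ ‖u 0‖ ^ 2 := by positivity
    have i4 : 0 ≤ ‖φ 0‖ ^ 2 := by positivity
    linarith
  calc _ ≤ K1 * (En + ‖u n‖ ^ 2 + ‖φ n‖ ^ 2) := hleft
    _ ≤ K1 * (X * ((3 + 3 / 2 * w2 + 3 / 2 * c ^ 2) * (‖u 0‖ ^ 2 + ‖timeDiff dt u 0‖ ^ 2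
        + ∑ d, ‖dPlusL2 h d (u 0)‖ ^ 2 + ‖φ 0‖ ^ 2))) := by
        gcongr
        exact hgrow.trans (by gcongr)
    _ = _ := by ring

theorem field_sq_bound (hw : 0 ≤ w2) (hW : 0 ≤ W) (he : 0 ≤ e) (he1 : e ≤ 1)
    (hdt : 0 < dt) (hdt1 : dt ≤ 1) (hq : 0 ≤ q) (hq1 : q < 1)
    (hcfl : ∀ f : GridL2 D, dt ^ 2 * ⟪spatialOp c w2 h f, f⟫ ≤ 4 * q * ‖f‖ ^ 2)
    (hsmall : 36 * (1 + W) / (1 - q) * dt ≤ 1 / 2)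
    (habs : IsAbstractSolution (spatialOp c w2 h) dt W e u φ) (n : ℕ) :
    ‖u n‖ ^ 2 + ‖φ n‖ ^ 2 ≤ (1 + 20 / (1 - q))
        * Real.exp (4 * (n * (36 * (1 + W) / (1 - q) * dt)))
        * (‖u 0‖ ^ 2 + ‖timeDiff dt u 0‖ ^ 2 + ‖φ 0‖ ^ 2) := by
  have h1q : 0 < 1 - q := by linarith
  -- The integrated estimate starts at level `1`, so level `0` is treated directly.
  rcases n with _ | n
  · have hK : 1 ≤ 1 + 20 / (1 - q) := by
      have : 0 < 20 / (1 - q) := by positivity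
      linarith
    have hv : 0 ≤ ‖timeDiff dt u 0‖ ^ 2 := by positivity
    simp only [Nat.cast_zero, zero_mul, mul_zero, Real.exp_zero, mul_one]
    refine le_trans ?_ (le_mul_of_one_le_left (by positivity) hK)
    linarith
  have hgrow := habs.integrated_growth (spatialOp_isSymmetric c w2 h) (spatialOp_nonneg hw) hdt
    hW he he1 hq hq1 hcfl hsmall n
  have h0 : u 1 = u 0 + dt • timeDiff dt u 0 := by rw [smul_timeDiff hdt.ne']; abel
  have hu1 : ‖u 1‖ ≤ ‖u 0‖ + ‖timeDiff dt u 0‖ := by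
    conv_lhs => rw [h0]
    refine (norm_add_le _ _).trans ?_
    rw [norm_smul, Real.norm_of_nonneg hdt.le]
    gcongr
    exact mul_le_of_le_one_left (norm_nonneg _) hdt1
  have hφ1 : ‖φ 1‖ ≤ ‖φ 0‖ + (‖u 0‖ + ‖u 1‖) :=
    (habs.norm_conv_le hdt.le he he1 0).trans
      (add_le_add le_rfl (mul_le_of_le_one_left (by positivity) hdt1))
  -- Squaring sums of two and three terms gives coefficients `14`, `6` and `3` for `u 0`, `v 0` and
  -- `φ 0`, all below `20`.
  have hdata : ‖u 1‖ ^ 2 + ‖timeDiff dt u 0‖ ^ 2 + ‖φ 1‖ ^ 2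
      ≤ 20 * (‖u 0‖ ^ 2 + ‖timeDiff dt u 0‖ ^ 2 + ‖φ 0‖ ^ 2) := by
    have i1 := pow_le_pow_left₀ (norm_nonneg _) hu1 2
    have i2 := pow_le_pow_left₀ (norm_nonneg _)
      (hφ1.trans (by linarith : _ ≤ ‖φ 0‖ + 2 * ‖u 0‖ + ‖timeDiff dt u 0‖)) 2
    nlinarith [sq_nonneg (‖u 0‖ - ‖timeDiff dt u 0‖), sq_nonneg (‖φ 0‖ - ‖timeDiff dt u 0‖),
      sq_nonneg (‖u 0‖ - ‖φ 0‖), sq_nonneg (‖u 0‖), sq_nonneg ‖timeDiff dt u 0‖,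
      sq_nonneg ‖φ 0‖]
  set Y := ‖u 0‖ ^ 2 + ‖timeDiff dt u 0‖ ^ 2 + ‖φ 0‖ ^ 2 with hY
  have hY0 : 0 ≤ Y := by positivity
  have hC0 : 0 ≤ 36 * (1 + W) / (1 - q) * dt := by positivity
  have hexp : Real.exp (4 * (n * (36 * (1 + W) / (1 - q) * dt)))
      ≤ Real.exp (4 * ((n + 1 : ℕ) * (36 * (1 + W) / (1 - q) * dt))) := by
    gcongr
    omega
  set X := Real.exp (4 * ((n + 1 : ℕ) * (36 * (1 + W) / (1 - q) * dt)))
  have hmain : (1 - q) * (‖u (n + 1)‖ ^ 2 + ‖φ (n + 1)‖ ^ 2) ≤ X * (20 * Y) := by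
    calc _ ≤ (1 - q) * ‖u (n + 1)‖ ^ 2 + ‖φ (n + 1)‖ ^ 2 := by
          have : 0 ≤ q * ‖φ (n + 1)‖ ^ 2 := by positivity
          linarith
      _ ≤ _ := hgrow
      _ ≤ _ := by gcongr
  have hX : 0 ≤ X := (Real.exp_pos _).le
  calc ‖u (n + 1)‖ ^ 2 + ‖φ (n + 1)‖ ^ 2 ≤ X * (20 * Y) / (1 - q) := by
        rw [le_div_iff₀ h1q]
        linarith
    _ = 20 / (1 - q) * X * Y := by ring
    _ ≤ _ := by
        gcongr
        linarith

end Bounds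

theorem finiteTimeStable_energyNorm {D : ℕ} {c w2 γ q : ℝ} (hc : 0 < c) (hw : 0 ≤ w2)
    (hγ : 0 ≤ γ) (hq1 : q < 1) :
    FiniteTimeStable (D := D) c w2 γ
      (fun dt h => cflNumber c dt h + plasmaNumber w2 dt ^ 2 / 4 ≤ q) energyNorm energyNorm := by
  have h1q : 0 < 1 - q := by linarith
  refine finiteTimeStable_of_sq_bound (C := 36 * (1 + w2 * γ) / (1 - q))
    (K := (1 + 1 / (1 - q) + (2 + 2 / (1 - q)) / c ^ 2) * (3 + 3 / 2 * w2 + 3 / 2 * c ^ 2))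
    hc hw hq1 (by positivity) ?_ (fun _ _ => Real.sqrt_nonneg _) ?_
  · have i1 : 0 ≤ 1 / (1 - q) + (2 + 2 / (1 - q)) / c ^ 2 := by positivity
    have i2 : 0 ≤ 3 / 2 * w2 + 3 / 2 * c ^ 2 := by positivity
    exact one_le_mul_of_one_le_of_one_le (by linarith) (by linarith)
  · intro dt h hdt _ hsmall hh hq hcfl E ψ u φ hu hφ habs n
    have hb := energy_sq_bound hc hw (by positivity) (Real.exp_pos _).le
      (Real.exp_le_one_iff.2 (by simpa using mul_nonneg hγ hdt.le)) hdt hq hq1 hcfl hsmall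
      habs n
    rw [energyNorm_sq hh hu hφ, energyNorm_sq hh hu hφ]
    have hV : 0 < ∏ d, h d := Finset.prod_pos fun d _ => hh d
    have := mul_le_mul_of_nonneg_left hb hV.le
    linarith

theorem finiteTimeStable_fieldNorm {D : ℕ} {c w2 γ q : ℝ} (hc : 0 < c) (hw : 0 ≤ w2)
    (hγ : 0 ≤ γ) (hq1 : q < 1) :
    FiniteTimeStable (D := D) c w2 γ
      (fun dt h => cflNumber c dt h + plasmaNumber w2 dt ^ 2 / 4 ≤ q) fieldNorm dataNorm := by
  have h1q : 0 < 1 - q := by linarith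
  refine finiteTimeStable_of_sq_bound (C := 36 * (1 + w2 * γ) / (1 - q))
    (K := 1 + 20 / (1 - q)) hc hw hq1 (by positivity) ?_ (fun _ _ => Real.sqrt_nonneg _) ?_
  · have i1 : 0 ≤ 20 / (1 - q) := by positivity
    linarith
  · intro dt h hdt hdt1 hsmall hh hq hcfl E ψ u φ hu hφ habs n
    have hb := field_sq_bound hw (by positivity) (Real.exp_pos _).le
      (Real.exp_le_one_iff.2 (by simpa using mul_nonneg hγ hdt.le)) hdt hdt1 hq hq1 hcfl hsmall
      habs n
    rw [fieldNorm_sq hh hu hφ, dataNorm_sq hh hu hφ]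
    have hV : 0 < ∏ d, h d := Finset.prod_pos fun d _ => hh d
    have := mul_le_mul_of_nonneg_left hb hV.le
    linarith

end RC2

end

theorem mainTheorem1 {D : ℕ} (c w2 γ : ℝ) (hc : 0 < c) (hw : 0 ≤ w2) (hγ : 0 ≤ γ) :
    -- finite-time stability in the discrete energy norm
    (∀ q : ℝ, q < 1 →
      RC2.FiniteTimeStable (D := D) c w2 γ
        (fun dt h => RC2.cflNumber c dt h + RC2.plasmaNumber w2 dt ^ 2 / 4 ≤ q)
        RC2.energyNorm RC2.energyNorm) ∧
    -- finite-time stability in the discrete L² norm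
    (∀ q : ℝ, q < 1 →
      RC2.FiniteTimeStable (D := D) c w2 γ
        (fun dt h => RC2.cflNumber c dt h + RC2.plasmaNumber w2 dt ^ 2 / 4 ≤ q)
        RC2.fieldNorm RC2.dataNorm) ∧
    -- the amplification factors of every wave number
    (0 < w2 → 0 < γ → ∀ (dt : ℝ) (h : Fin D → ℝ), 0 < dt → (∀ d, 0 < h d) →
      RC2.cflNumber c dt h + RC2.plasmaNumber w2 dt ^ 2 / 4 < 1 →
      ∀ ξ : Fin D → ℝ, ∃ (A₀ : ℝ) (Ap Am : ℂ),
        (∀ A : ℂ, (RC2.ampMatrix (RC2.lapSymbol c dt h ξ) (RC2.plasmaNumber w2 dt)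
            (γ * dt) A).det = (A - (A₀ : ℂ)) * (A - Ap) * (A - Am)) ∧
        ‖Ap‖ < 1 ∧ ‖Am‖ < 1 ∧ 0 < A₀ ∧
        A₀ ≤ (RC2.spuriousRoot (RC2.plasmaNumber w2 dt) (γ * dt)).re) ∧
    -- the constant mode
    (∀ Ω Γ : ℝ, 0 < Ω → Ω < 2 → 0 < Γ →
      (∀ A : ℂ, (RC2.ampMatrix 0 Ω Γ A).det
        = (A - RC2.spuriousRoot Ω Γ) * (A - RC2.pairRoot 1 Ω Γ)
          * (A - RC2.pairRoot (-1) Ω Γ)) ∧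
      (RC2.spuriousRoot Ω Γ).im = 0 ∧ 1 < (RC2.spuriousRoot Ω Γ).re ∧
      ‖RC2.pairRoot 1 Ω Γ‖ < 1 ∧ ‖RC2.pairRoot (-1) Ω Γ‖ < 1) ∧
    -- expansion of the spurious root for fixed Ω
    (∀ Ω : ℝ, 0 < Ω → Ω < 2 →
      (fun Γ : ℝ => RC2.spuriousRoot Ω Γ - (1 + (Γ : ℂ) ^ 3 / 12))
        =O[𝓝[>] (0 : ℝ)] fun Γ : ℝ => Γ ^ 4) ∧
    -- expansion of the spurious root, and its growth rate, as Δt → 0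
    (0 < w2 → 0 < γ →
      ((fun dt : ℝ => RC2.spuriousRoot (RC2.plasmaNumber w2 dt) (γ * dt)
          - (1 + ((γ * dt : ℝ) : ℂ) ^ 3 / 12)) =O[𝓝[>] (0 : ℝ)] fun dt : ℝ => dt ^ 4) ∧
      ((fun dt : ℝ => Real.log ‖RC2.spuriousRoot (RC2.plasmaNumber w2 dt) (γ * dt)‖ / dt)
          =O[𝓝[>] (0 : ℝ)] fun dt : ℝ => dt ^ 2) ∧
      Tendsto (fun dt : ℝ =>
          Real.log ‖RC2.spuriousRoot (RC2.plasmaNumber w2 dt) (γ * dt)‖ / dt)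
        (𝓝[>] (0 : ℝ)) (𝓝 0)) := by
  refine ⟨fun q hq => RC2.finiteTimeStable_energyNorm hc hw hγ hq,
    fun q hq => RC2.finiteTimeStable_fieldNorm hc hw hγ hq, ?_, ?_,
    fun Ω hΩ hΩ2 => RC2.spuriousRoot_isBigO hΩ hΩ2, fun hw hγ =>
      ⟨RC2.spuriousRoot_isBigO_dt hw hγ, RC2.growthRate_isBigO hw hγ,
        RC2.growthRate_tendsto hw hγ⟩⟩
  · intro hw hγ dt h hdt _ hadm ξ
    refine RC2.amplification_factors (RC2.lapSymbol_nonneg c dt h ξ)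
      (RC2.plasmaNumber_pos hw hdt) (mul_pos hγ hdt) ?_
    have hΛ := RC2.cflNumber_nonneg hc.le hdt.le h
    have hΩ : 0 < RC2.plasmaNumber w2 dt ^ 2 := pow_pos (RC2.plasmaNumber_pos hw hdt) 2
    have hS := RC2.lapSymbol_le c dt h ξ
    -- `S + Ω² ≤ 4Λ² + Ω² ≤ 4Λ + Ω² < 4`, using `Λ < 1`.
    nlinarith
  · intro Ω Γ hΩ hΩ2 hΓ
    obtain ⟨r, a, β, hr, hA, hp, hm, h2, h1, h0, hn1, hn2, -⟩ :=
      RC2.spuriousRoot_spec hΩ hΩ2 hΓ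
    rw [hA, hp, hm]
    exact ⟨RC2.det_ampMatrix_eq_of_coeffs h2 h1 h0, Complex.ofReal_im r,
      by rwa [Complex.ofReal_re], hn1, hn2⟩
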